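/- Let INDEPENDENT CUTSET be the problem of deciding whether a finite connected simple graph $G$ has an independent cutset, i.e. a set $S$ of pairwise nonadjacent vertices such that $G-S$ is disconnected (has at least two components). A dominating set of $G$ is a set $X$ of vertices such that every vertex of $G$ is in $X$ or has a neighbor in $X$. \textbf{Theorem.} There are an algorithm and a polynomial $p$ such that the following holds for every connected graph $G$ with $n$ vertices and every dominating set $X$ of $G$. Given $G$ and $X$ as input, the algorithm halts after at most $3^{k}\cdot p(n)$ steps, where $k=|X|$, and either returns an independent cutset of $G$ or correctly reports that $G$ has none. In other words, INDEPENDENT CUTSET with a dominating set $X$ as additional input can be solved, and an independent cutset be found if there is one, in time $\mathcal{O}^*(3^{|X|})$, where $\mathcal{O}^*$ suppresses factors polynomial in the size of the input. Here an algorithm is a deterministic random access machine program operating on registers and arrays of natural numbers, with constants, copying, indexed array access, successor, predecessor, comparisons, conditionals and while-loops, at unit cost per operation; $G$ is given by its adjacency matrix and $X$ by its characteristic vector. -/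

import Mathlib

/-! ### Graph notions -/

/-- Every vertex of `G` is in `X` or has a neighbour in `X`. -/
def SimpleGraph.IsDominatingSet {V : Type*} (G : SimpleGraph V) (X : Set V) : Prop :=
  ∀ v, v ∈ X ∨ ∃ x ∈ X, G.Adj v x

/-- `S` is a cutset of `G` if `G - S` is disconnected, i.e. has two vertices that no path of
`G - S` joins. (So the graph without vertices is not disconnected.) -/
def SimpleGraph.IsCutset {V : Type*} (G : SimpleGraph V) (S : Set V) : Prop :=
  ¬ (G.induce Sᶜ).Preconnected

/-- An independent cutset is a cutset whose vertices are pairwise nonadjacent. -/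
def SimpleGraph.IsIndependentCutset {V : Type*} (G : SimpleGraph V) (S : Set V) : Prop :=
  G.IsCutset S ∧ G.IsIndepSet S

/-! ### A random access machine with structured control and a step count

The memory consists of scalar registers and of one-dimensional arrays, all holding natural
numbers; a fixed program refers to finitely many registers and arrays. The only arithmetic is
successor and predecessor, so a run of `t` steps on an input whose entries are at most `m` only
produces numbers that are at most `m + t` plus a constant depending on the program. Hence charging
one unit per operation hides no more than a factor logarithmic in the running time. -/

namespace RAM

/-- Memory contents: `var x` is scalar register `x`, and `arr a i` is cell `i` of array `a`. -/
@[ext]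
structure State where
  var : ℕ → ℕ
  arr : ℕ → ℕ → ℕ

/-- Expressions: numerals, registers, array cells `a[e]`, successor and (truncated)
predecessor. -/
inductive Expr where
  | const (c : ℕ)
  | var (x : ℕ)
  | get (a : ℕ) (e : Expr)
  | succ (e : Expr)
  | pred (e : Expr)

namespace Expr

/-- Value of an expression in a memory state. -/
def value (s : State) : Expr → ℕ
  | const c => c
  | var x => s.var x
  | get a e => s.arr a (value s e)
  | succ e => value s e + 1
  | pred e => value s e - 1

/-- Evaluating an expression costs one step per operation in it. -/
def cost : Expr → ℕ
  | const _ => 1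
  | var _ => 1
  | get _ e => cost e + 1
  | succ e => cost e + 1
  | pred e => cost e + 1

end Expr

/-- Tests compare two values. -/
inductive Test where
  | eq (e₁ e₂ : Expr)
  | lt (e₁ e₂ : Expr)

namespace Test

/-- The test succeeds in a memory state. -/
def Holds (s : State) : Test → Prop
  | eq e₁ e₂ => e₁.value s = e₂.value s
  | lt e₁ e₂ => e₁.value s < e₂.value s

/-- Evaluating a test costs the evaluation of both sides and one step for the comparison. -/
def cost : Test → ℕ
  | eq e₁ e₂ => e₁.cost + e₂.cost + 1
  | lt e₁ e₂ => e₁.cost + e₂.cost + 1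

end Test

/-- Programs. `assign x e` is `x := e`, `store a i e` is `a[i] := e`, and `loop b c` is
`while b do c`. -/
inductive Program where
  | skip
  | assign (x : ℕ) (e : Expr)
  | store (a : ℕ) (i e : Expr)
  | seq (c₁ c₂ : Program)
  | cond (b : Test) (c₁ c₂ : Program)
  | loop (b : Test) (c : Program)

/-- `Run P s t s'`: started in memory `s`, program `P` halts after exactly `t` steps with
memory `s'`. -/
inductive Run : Program → State → ℕ → State → Prop where
  | skip (s : State) : Run .skip s 1 s
  | assign (s : State) (x : ℕ) (e : Expr) :
      Run (.assign x e) s (e.cost + 1) { s with var := Function.update s.var x (e.value s) }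
  | store (s : State) (a : ℕ) (i e : Expr) :
      Run (.store a i e) s (i.cost + e.cost + 1)
        { s with
          arr := Function.update s.arr a (Function.update (s.arr a) (i.value s) (e.value s)) }
  | seq {s₁ s₂ s₃ : State} {c₁ c₂ : Program} {t₁ t₂ : ℕ}
      (h₁ : Run c₁ s₁ t₁ s₂) (h₂ : Run c₂ s₂ t₂ s₃) : Run (.seq c₁ c₂) s₁ (t₁ + t₂) s₃
  | cond_true {s₁ s₂ : State} {b : Test} {c₁ c₂ : Program} {t : ℕ}
      (hb : b.Holds s₁) (h : Run c₁ s₁ t s₂) : Run (.cond b c₁ c₂) s₁ (b.cost + t) s₂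
  | cond_false {s₁ s₂ : State} {b : Test} {c₁ c₂ : Program} {t : ℕ}
      (hb : ¬ b.Holds s₁) (h : Run c₂ s₁ t s₂) : Run (.cond b c₁ c₂) s₁ (b.cost + t) s₂
  | loop_true {s₁ s₂ s₃ : State} {b : Test} {c : Program} {t₁ t₂ : ℕ}
      (hb : b.Holds s₁) (h₁ : Run c s₁ t₁ s₂) (h₂ : Run (.loop b c) s₂ t₂ s₃) :
      Run (.loop b c) s₁ (b.cost + t₁ + t₂) s₃
  | loop_false {s : State} {b : Test} {c : Program}
      (hb : ¬ b.Holds s) : Run (.loop b c) s b.cost s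

/-- The machine is deterministic: the program and the initial memory determine the number of
steps and the final memory. -/
theorem Run.deterministic {P : Program} {s s₁ s₂ : State} {t₁ t₂ : ℕ}
    (h₁ : Run P s t₁ s₁) (h₂ : Run P s t₂ s₂) : t₁ = t₂ ∧ s₁ = s₂ := by
  induction h₁ generalizing t₂ s₂ with
  | skip s => cases h₂; exact ⟨rfl, rfl⟩
  | assign s x e => cases h₂; exact ⟨rfl, rfl⟩
  | store s a i e => cases h₂; exact ⟨rfl, rfl⟩
  | seq _ _ ih₁ ih₂ =>
    cases h₂ with
    | seq g₁ g₂ =>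
      obtain ⟨rfl, rfl⟩ := ih₁ g₁
      obtain ⟨rfl, rfl⟩ := ih₂ g₂
      exact ⟨rfl, rfl⟩
  | cond_true hb _ ih =>
    cases h₂ with
    | cond_true _ g => obtain ⟨rfl, rfl⟩ := ih g; exact ⟨rfl, rfl⟩
    | cond_false hn _ => exact absurd hb hn
  | cond_false hb _ ih =>
    cases h₂ with
    | cond_true hp _ => exact absurd hp hb
    | cond_false _ g => obtain ⟨rfl, rfl⟩ := ih g; exact ⟨rfl, rfl⟩
  | loop_true hb _ _ ih₁ ih₂ =>
    cases h₂ with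
    | loop_true _ g₁ g₂ =>
      obtain ⟨rfl, rfl⟩ := ih₁ g₁
      obtain ⟨rfl, rfl⟩ := ih₂ g₂
      exact ⟨rfl, rfl⟩
    | loop_false hn => exact absurd hb hn
  | loop_false hb =>
    cases h₂ with
    | loop_true hp _ _ => exact absurd hp hb
    | loop_false _ => exact ⟨rfl, rfl⟩

end RAM

/-! ### Input and output -/

open Classical in
/-- The initial memory for the input `(G, X)`: register `0` holds the number `n` of vertices,
array `0` holds the adjacency matrix of `G` row by row, array `1` holds the characteristic vector
of `X`, and all the rest is `0`. -/
noncomputable def inputState {n : ℕ} (G : SimpleGraph (Fin n)) (X : Finset (Fin n)) :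
    RAM.State where
  var x := if x = 0 then n else 0
  arr a i :=
    if a = 0 then (if ∃ u v : Fin n, G.Adj u v ∧ i = (u : ℕ) * n + v then 1 else 0)
    else if a = 1 then (if ∃ v ∈ X, i = (v : ℕ) then 1 else 0)
    else 0

/-- The final memory `s` is a correct answer for `G`: either register `0` holds `1` ("yes") and
array `2` is the characteristic vector of an independent cutset of `G`, or register `0` holds `0`
("no") and `G` has no independent cutset. -/
def IsCorrectAnswer {n : ℕ} (G : SimpleGraph (Fin n)) (s : RAM.State) : Prop :=
  (s.var 0 = 1 ∧ (∀ v : Fin n, s.arr 2 v = 0 ∨ s.arr 2 v = 1) ∧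
      G.IsIndependentCutset {v : Fin n | s.arr 2 v = 1}) ∨
    (s.var 0 = 0 ∧ ¬ ∃ S : Set (Fin n), G.IsIndependentCutset S)

/-! ### Bounded loop programs: evaluation, frame rules, running time -/

namespace RAM

/-! An independent cutset amounts to a labelling of the vertices by 0, 1, 2 in which 0 and 2 both
occur, no edge joins 0 to 2 and no edge joins 1 to 1: label 1 marks the cutset, labels 0 and 2 mark
two sides of the rest. Both prohibitions say that the labels at the ends of an edge do not add up to
2, so each label is incompatible with exactly one label.

The algorithm runs through the `3 ^ k` labellings of `X` with a ternary counter and, for each,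
through the pairs `(a, b)` of vertices that are to receive 0 and 2. A vertex outside `X` has a
neighbour in `X`, whose label rules out one of the three, so at most two candidates remain: a
problem of 2-SAT type. It is solved with lists of candidate labels and arc consistency. The decisive
lemma is `IsClosed.exists_isLabelling`: if some labelling `f` agrees with the lists on `X`, then
nonempty arc consistent lists contain a labelling. Indeed, a vertex whose list lacks the label from
`f` has only one label left, and arc consistency makes this label compatible with whatever its
neighbours take; all other vertices follow `f`.

Hence it is safe to delete one label, propagate, and keep the result whenever no list becomes empty
(`IsTrial.isDecidedOn`). If a labelling exists, the lists are singletons after all trials. Soundness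
does not rest on this: an answer is only produced from nonempty arc consistent lists with at most
one label each, and these are a labelling.

As to time, all that happens inside the main loop is built from loops up to `n`, so its polynomial
bound is read off the syntax (`exists_run`). The main loop runs once for each of the `3 ^ k` counter
values. -/

instance (b : Test) (s : State) : Decidable (b.Holds s) := by
  cases b <;> unfold Test.Holds <;> infer_instance

/-- Memory `s` with register `x` set to `m`. -/
def State.setVar (s : State) (x m : ℕ) : State := { s with var := Function.update s.var x m }

/-- Memory `s` with cell `i` of array `a` set to `m`. -/
def State.setArr (s : State) (a i m : ℕ) : State :=
  { s with arr := Function.update s.arr a (Function.update (s.arr a) i m) }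

@[simp] theorem State.setVar_arr (s : State) (x m : ℕ) : (s.setVar x m).arr = s.arr := rfl

@[simp] theorem State.setArr_var (s : State) (a i m : ℕ) : (s.setArr a i m).var = s.var := rfl

theorem State.setVar_var (s : State) (x m y : ℕ) :
    (s.setVar x m).var y = if y = x then m else s.var y := by
  simp [State.setVar, Function.update_apply]

theorem State.setArr_arr (s : State) (a i m b j : ℕ) :
    (s.setArr a i m).arr b j = if b = a ∧ j = i then m else s.arr b j := by
  by_cases hb : b = a
  · subst hb
    simp [State.setArr, Function.update_apply]
  · simp [State.setArr, hb]

/-- Programs whose only loops are `for x < n`, where `n` is the content of register `0`. -/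
inductive LoopProgram where
  | skip
  | assign (x : ℕ) (e : Expr)
  | store (a : ℕ) (i e : Expr)
  | seq (P Q : LoopProgram)
  | cond (b : Test) (P Q : LoopProgram)
  | forLoop (x : ℕ) (P : LoopProgram)

namespace LoopProgram

/-- The translation to programs of the machine. -/
def toProgram : LoopProgram → Program
  | skip => .skip
  | assign x e => .assign x e
  | store a i e => .store a i e
  | seq P Q => .seq P.toProgram Q.toProgram
  | cond b P Q => .cond b P.toProgram Q.toProgram
  | forLoop x P =>
      .seq (.assign x (.const 0))
        (.loop (.lt (.var x) (.var 0)) (.seq P.toProgram (.assign x (.succ (.var x)))))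

/-- The final memory of a loop program. -/
def eval : LoopProgram → State → State
  | skip, s => s
  | assign x e, s => s.setVar x (e.value s)
  | store a i e, s => s.setArr a (i.value s) (e.value s)
  | seq P Q, s => Q.eval (P.eval s)
  | cond b P Q, s => if b.Holds s then P.eval s else Q.eval s
  | forLoop x P, s =>
      (fun r => (P.eval r).setVar x ((P.eval r).var x + 1))^[s.var 0] (s.setVar x 0)

/-- Whether the program contains an assignment to register `y`. -/
def writesVar (y : ℕ) : LoopProgram → Bool
  | skip => false
  | assign x _ => y == x
  | store _ _ _ => false
  | seq P Q => P.writesVar y || Q.writesVar y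
  | cond _ P Q => P.writesVar y || Q.writesVar y
  | forLoop x P => y == x || P.writesVar y

/-- Whether the program contains a write access to array `b`. -/
def writesArr (b : ℕ) : LoopProgram → Bool
  | skip => false
  | assign _ _ => false
  | store a _ _ => b == a
  | seq P Q => P.writesArr b || Q.writesArr b
  | cond _ P Q => P.writesArr b || Q.writesArr b
  | forLoop _ P => P.writesArr b

/-- Loop counters and register `0` are not overwritten inside the program. -/
def wellFormed : LoopProgram → Bool
  | skip => true
  | assign x _ => x != 0
  | store _ _ _ => true
  | seq P Q => P.wellFormed && Q.wellFormed
  | cond _ P Q => P.wellFormed && Q.wellFormed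
  | forLoop x P => x != 0 && P.wellFormed && !P.writesVar x

/-- A bound for the number of steps, as a polynomial in the content of register `0`. -/
noncomputable def cost : LoopProgram → Polynomial ℕ
  | skip => 1
  | assign _ e => .C (e.cost + 1)
  | store _ i e => .C (i.cost + e.cost + 1)
  | seq P Q => P.cost + Q.cost
  | cond b P Q => .C b.cost + P.cost + Q.cost
  -- Each round pays 3 for the test and 3 for the increment of the counter; the initial assignment
  -- costs 2 and the last, failing test 3.
  | forLoop _ P => .X * (P.cost + 6) + 5

theorem eval_skip (s : State) : skip.eval s = s := rfl

theorem eval_assign (x : ℕ) (e : Expr) (s : State) :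
    (assign x e).eval s = s.setVar x (e.value s) := rfl

theorem eval_store (a : ℕ) (i e : Expr) (s : State) :
    (store a i e).eval s = s.setArr a (i.value s) (e.value s) := rfl

theorem eval_seq (P Q : LoopProgram) (s : State) : (seq P Q).eval s = Q.eval (P.eval s) := rfl

/-- Choice between two memories by comparison of two numbers. -/
def select (x y : ℕ) (s r : State) : State := if x = y then s else r

theorem select_eq_ite (x y : ℕ) (s r : State) : select x y s r = if x = y then s else r := by
  by_cases h : x = y
  · rw [select, if_pos h]
  · rw [select, if_neg h]

theorem eval_cond_eq (e₁ e₂ : Expr) (P Q : LoopProgram) (s : State) :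
    (cond (.eq e₁ e₂) P Q).eval s = select (e₁.value s) (e₂.value s) (P.eval s) (Q.eval s) := rfl

/-- Frame rule. As `writesVar` is a Boolean function of the syntax, its hypothesis is closed by
`rfl` for concrete programs; the same holds for arrays below. -/
theorem eval_var_of_not_writesVar {y : ℕ} (P : LoopProgram) (h : P.writesVar y = false)
    (s : State) : (P.eval s).var y = s.var y := by
  induction P generalizing s with
  | skip => rfl
  | assign x e =>
    simp only [writesVar, beq_eq_false_iff_ne] at h
    simp [eval, State.setVar_var, h]
  | store a i e => rfl
  | seq P Q ihP ihQ =>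
    simp only [writesVar, Bool.or_eq_false_iff] at h
    simp [eval, ihP h.1, ihQ h.2]
  | cond b P Q ihP ihQ =>
    simp only [writesVar, Bool.or_eq_false_iff] at h
    simp only [eval]
    split
    · exact ihP h.1 s
    · exact ihQ h.2 s
  | forLoop x P ih =>
    simp only [writesVar, Bool.or_eq_false_iff, beq_eq_false_iff_ne] at h
    simp only [eval]
    have key (k : ℕ) (r : State) :
        ((fun r => (P.eval r).setVar x ((P.eval r).var x + 1))^[k] r).var y = r.var y := by
      induction k generalizing r with
      | zero => rfl
      | succ k ihk => rw [Function.iterate_succ_apply, ihk, State.setVar_var, if_neg h.1, ih h.2]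
    rw [key, State.setVar_var, if_neg h.1]

theorem eval_arr_of_not_writesArr {b : ℕ} (P : LoopProgram) (h : P.writesArr b = false)
    (s : State) : (P.eval s).arr b = s.arr b := by
  induction P generalizing s with
  | skip => rfl
  | assign x e => rfl
  | store a i e =>
    simp only [writesArr, beq_eq_false_iff_ne] at h
    simp [eval, State.setArr, h]
  | seq P Q ihP ihQ =>
    simp only [writesArr, Bool.or_eq_false_iff] at h
    simp [eval, ihP h.1, ihQ h.2]
  | cond b P Q ihP ihQ =>
    simp only [writesArr, Bool.or_eq_false_iff] at h
    simp only [eval]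
    split
    · exact ihP h.1 s
    · exact ihQ h.2 s
  | forLoop x P ih =>
    simp only [writesArr] at h
    simp only [eval]
    have key (k : ℕ) (r : State) :
        ((fun r => (P.eval r).setVar x ((P.eval r).var x + 1))^[k] r).arr b = r.arr b := by
      induction k generalizing r with
      | zero => rfl
      | succ k ihk => rw [Function.iterate_succ_apply, ihk, State.setVar_arr, ih h]
    rw [key, State.setVar_arr]

theorem writesVar_zero_of_wellFormed (P : LoopProgram) (h : P.wellFormed = true) :
    P.writesVar 0 = false := by
  induction P with
  | skip => rfl
  | assign x e =>
    simp only [wellFormed, bne_iff_ne] at h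
    simpa [writesVar] using h.symm
  | store a i e => rfl
  | seq P Q ihP ihQ => simp_all [wellFormed, writesVar]
  | cond b P Q ihP ihQ => simp_all [wellFormed, writesVar]
  | forLoop x P ih =>
    simp only [wellFormed, Bool.and_eq_true, bne_iff_ne] at h
    simp [writesVar, ih h.1.2, h.1.1.symm]

/-- A loop program takes polynomially many steps. -/
theorem exists_run (P : LoopProgram) (h : P.wellFormed = true) (s : State) :
    ∃ t ≤ P.cost.eval (s.var 0), Run P.toProgram s t (P.eval s) := by
  induction P generalizing s with
  | skip => exact ⟨1, by simp [cost], Run.skip s⟩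
  | assign x e => exact ⟨_, by simp [cost], Run.assign s x e⟩
  | store a i e => exact ⟨_, by simp [cost], Run.store s a i e⟩
  | seq P Q ihP ihQ =>
    simp only [wellFormed, Bool.and_eq_true] at h
    obtain ⟨t₁, ht₁, h₁⟩ := ihP h.1 s
    obtain ⟨t₂, ht₂, h₂⟩ := ihQ h.2 (P.eval s)
    rw [eval_var_of_not_writesVar P (writesVar_zero_of_wellFormed P h.1)] at ht₂
    exact ⟨_, by simp only [cost, Polynomial.eval_add]; omega, Run.seq h₁ h₂⟩
  | cond b P Q ihP ihQ =>
    simp only [wellFormed, Bool.and_eq_true] at h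
    simp only [cost, Polynomial.eval_add, Polynomial.eval_C, eval, toProgram]
    split
    next hb =>
      obtain ⟨t, ht, hr⟩ := ihP h.1 s
      exact ⟨_, by omega, Run.cond_true hb hr⟩
    next hb =>
      obtain ⟨t, ht, hr⟩ := ihQ h.2 s
      exact ⟨_, by omega, Run.cond_false hb hr⟩
  | forLoop x P ih =>
    simp only [wellFormed, Bool.and_eq_true, bne_iff_ne, Bool.not_eq_true'] at h
    obtain ⟨⟨hx, hP⟩, hw⟩ := h
    have h0 := writesVar_zero_of_wellFormed P hP
    -- Here `k` is the number of rounds still to be made. The bound stays valid because neither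
    -- register 0 nor the counter is changed by the body.
    have key (k : ℕ) (r : State) (hr : r.var x + k = r.var 0) :
        ∃ t ≤ k * (P.cost.eval (r.var 0) + 6) + 3,
          Run (.loop (.lt (.var x) (.var 0)) (.seq P.toProgram (.assign x (.succ (.var x))))) r t
            ((fun r => (P.eval r).setVar x ((P.eval r).var x + 1))^[k] r) := by
      induction k generalizing r with
      | zero =>
        refine ⟨_, le_of_eq ?_, Run.loop_false ?_⟩
        · simp [Test.cost, Expr.cost]
        · simp only [Test.Holds, Expr.value]
          omega
      | succ k ihk =>
        obtain ⟨t₁, ht₁, h₁⟩ := ih hP r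
        have e0 : ((P.eval r).setVar x ((P.eval r).var x + 1)).var 0 = r.var 0 := by
          rw [State.setVar_var, if_neg hx.symm, eval_var_of_not_writesVar P h0]
        have ex : ((P.eval r).setVar x ((P.eval r).var x + 1)).var x = r.var x + 1 := by
          rw [State.setVar_var, if_pos rfl, eval_var_of_not_writesVar P hw]
        obtain ⟨t₂, ht₂, h₂⟩ := ihk ((P.eval r).setVar x ((P.eval r).var x + 1))
          (by rw [e0, ex]; omega)
        rw [e0] at ht₂
        refine ⟨_, ?_, Run.loop_true ?_ (Run.seq h₁ (Run.assign _ x _)) h₂⟩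
        · simp only [Test.cost, Expr.cost]
          rw [add_mul, one_mul]
          omega
        · simp only [Test.Holds, Expr.value]
          omega
    have e0 : (s.setVar x 0).var 0 = s.var 0 := by rw [State.setVar_var, if_neg hx.symm]
    obtain ⟨t, ht, hr⟩ := key (s.var 0) (s.setVar x 0) (by rw [e0, State.setVar_var]; simp)
    rw [e0] at ht
    refine ⟨_, ?_, Run.seq (Run.assign s x (.const 0)) hr⟩
    simp only [cost, Polynomial.eval_add, Polynomial.eval_mul, Polynomial.eval_X,
      Polynomial.eval_ofNat, Expr.cost]
    omega

/-- Invariant rule for `for` loops. -/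
theorem eval_forLoop_induction {x : ℕ} {P : LoopProgram} (s : State)
    (hwf : (forLoop x P).wellFormed = true) (I : ℕ → State → Prop)
    (base : I 0 (s.setVar x 0))
    (step : ∀ i r, i < s.var 0 → r.var x = i →
      (∀ y, (forLoop x P).writesVar y = false → r.var y = s.var y) →
      (∀ a, (forLoop x P).writesArr a = false → r.arr a = s.arr a) →
      I i r → I (i + 1) ((P.eval r).setVar x (i + 1))) :
    I (s.var 0) ((forLoop x P).eval s) := by
  simp only [wellFormed, Bool.and_eq_true, bne_iff_ne, Bool.not_eq_true'] at hwf
  obtain ⟨⟨hx, hP⟩, hw⟩ := hwf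
  set f : State → State := fun r => (P.eval r).setVar x ((P.eval r).var x + 1) with hf
  -- The invariant is carried along with the value of the counter and the frame conditions, so that
  -- `step` may use these without including them in `I`.
  have key (k : ℕ) (hk : k ≤ s.var 0) : I k (f^[k] (s.setVar x 0)) ∧
      (f^[k] (s.setVar x 0)).var x = k ∧
      (∀ y, (forLoop x P).writesVar y = false → (f^[k] (s.setVar x 0)).var y = s.var y) ∧
      (∀ a, (forLoop x P).writesArr a = false → (f^[k] (s.setVar x 0)).arr a = s.arr a) := by
    induction k with
    | zero =>
      refine ⟨base, by simp [State.setVar_var], fun y hy => ?_, fun a ha => rfl⟩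
      simp only [writesVar, Bool.or_eq_false_iff, beq_eq_false_iff_ne] at hy
      simp [State.setVar_var, hy.1]
    | succ k ihk =>
      obtain ⟨h1, h2, h3, h4⟩ := ihk (by omega)
      have ex := eval_var_of_not_writesVar P hw (f^[k] (s.setVar x 0))
      rw [Function.iterate_succ_apply']
      have hfe : f (f^[k] (s.setVar x 0)) = (P.eval (f^[k] (s.setVar x 0))).setVar x (k + 1) := by
        simp only [hf] at ex h2 ⊢
        rw [ex, h2]
      rw [hfe]
      refine ⟨step k _ (by omega) h2 h3 h4 h1, by simp [State.setVar_var], fun y hy => ?_,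
        fun a ha => ?_⟩
      · have hy' := hy
        simp only [writesVar, Bool.or_eq_false_iff, beq_eq_false_iff_ne] at hy'
        rw [State.setVar_var, if_neg hy'.1, eval_var_of_not_writesVar P hy'.2, h3 y hy]
      · rw [State.setVar_arr, eval_arr_of_not_writesArr P (by simpa [writesArr] using ha), h4 a ha]
  exact (key _ le_rfl).1

end LoopProgram

end RAM

/-! ### Separation labellings and their list version -/

namespace Separation

open Finset

/-- `g` labels the numbers below `n` by `0`, `1`, `2` such that no edge of `A` joins `0` and `2`
or two vertices with label `1`. -/
def IsLabelling (n : ℕ) (A : ℕ → ℕ → Prop) (g : ℕ → ℕ) : Prop :=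
  (∀ v < n, g v < 3) ∧ ∀ u < n, ∀ v < n, A u v → g u + g v ≠ 2

/-- The pairs (label, vertex) below `(3, n)`. -/
def box (n : ℕ) : Finset (ℕ × ℕ) := range 3 ×ˢ range n

/-- Arc consistency of the lists `Q`: every label in the list of `u` is compatible with some label
in the list of each neighbour of `u`. -/
def IsClosed (n : ℕ) (A : ℕ → ℕ → Prop) (Q : Finset (ℕ × ℕ)) : Prop :=
  ∀ c, ∀ u < n, ∀ v < n, (c, u) ∈ Q → A u v → ∃ y, (y, v) ∈ Q ∧ c + y ≠ 2

/-- All lists are nonempty. -/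
def IsFull (n : ℕ) (Q : Finset (ℕ × ℕ)) : Prop := ∀ v < n, ∃ c, (c, v) ∈ Q

/-- The lists that allow only the labelling `g`. -/
def graphOn (n : ℕ) (g : ℕ → ℕ) : Finset (ℕ × ℕ) := (range n).image fun v => (g v, v)

theorem mem_graphOn {n : ℕ} {g : ℕ → ℕ} {c v : ℕ} : (c, v) ∈ graphOn n g ↔ v < n ∧ g v = c := by
  simp only [graphOn, mem_image, mem_range, Prod.mk.injEq]
  constructor
  · rintro ⟨w, hw, h, rfl⟩
    exact ⟨hw, h⟩
  · rintro ⟨hv, h⟩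
    exact ⟨v, hv, h, rfl⟩

theorem mem_box {n c v : ℕ} : (c, v) ∈ box n ↔ c < 3 ∧ v < n := by
  simp [box]

theorem card_box (n : ℕ) : (box n).card = 3 * n := by
  simp [box]

theorem graphOn_subset_iff {n : ℕ} {g : ℕ → ℕ} {Q : Finset (ℕ × ℕ)} :
    graphOn n g ⊆ Q ↔ ∀ v < n, (g v, v) ∈ Q := by
  constructor
  · exact fun h v hv => h (mem_graphOn.2 ⟨hv, rfl⟩)
  · rintro h ⟨c, v⟩ hm
    obtain ⟨hv, rfl⟩ := mem_graphOn.1 hm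
    exact h v hv

variable {n : ℕ} {A : ℕ → ℕ → Prop} {Q T : Finset (ℕ × ℕ)} {f g : ℕ → ℕ}

/-- Labellings are thus particular arc consistent lists, and pruning that respects all arc
consistent sublists loses no labelling. -/
theorem IsLabelling.isClosed_graphOn (hg : IsLabelling n A g) : IsClosed n A (graphOn n g) := by
  intro c u hu v hv hc hA
  obtain ⟨-, rfl⟩ := mem_graphOn.1 hc
  exact ⟨g v, mem_graphOn.2 ⟨hv, rfl⟩, hg.2 u hu v hv hA⟩

theorem isFull_graphOn (n : ℕ) (g : ℕ → ℕ) : IsFull n (graphOn n g) :=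
  fun v hv => ⟨g v, mem_graphOn.2 ⟨hv, rfl⟩⟩

theorem IsFull.mono (hQ : IsFull n Q) (h : Q ⊆ T) : IsFull n T :=
  fun v hv => (hQ v hv).imp fun _ hc => h hc

/-- Nonempty arc consistent lists in which each vertex has at most one label are a labelling. -/
theorem IsClosed.exists_isLabelling_of_functional (hT : IsClosed n A T) (hfull : IsFull n T)
    (hbox : T ⊆ box n) (hfun : ∀ c d v, (c, v) ∈ T → (d, v) ∈ T → c = d) :
    ∃ g, IsLabelling n A g ∧ ∀ v < n, ∀ c, (c, v) ∈ T ↔ g v = c := by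
  choose! g hg using hfull
  refine ⟨g, ⟨fun v hv => (mem_box.1 (hbox (hg v hv))).1, fun u hu v hv hA => ?_⟩,
    fun v hv c => ⟨fun h => hfun _ _ _ (hg v hv) h, fun h => h ▸ hg v hv⟩⟩
  obtain ⟨y, hy, hne⟩ := hT _ u hu v hv (hg u hu) hA
  rwa [hfun _ _ _ (hg v hv) hy]

/-- If some labelling `f` agrees with the lists on a dominating set, then nonempty arc consistent
lists contain a labelling. -/
theorem IsClosed.exists_isLabelling (hT : IsClosed n A T) (hfull : IsFull n T) (hbox : T ⊆ box n)
    (hA : ∀ u < n, ∀ v < n, A u v → A v u) (hf : IsLabelling n A f) {D : ℕ → Prop}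
    (hdom : ∀ v < n, D v ∨ ∃ x < n, D x ∧ A v x)
    (hD : ∀ c x, D x → (c, x) ∈ T → c = f x) :
    ∃ g, IsLabelling n A g ∧ graphOn n g ⊆ T := by
  classical
  choose! p hp using hfull
  -- Such a `u` is outside `D`, so it has a neighbour `x` in `D`, whose only possible label is `f
  -- x`. Exactly two labels are compatible with `f x`; one of them is `f u`, which is missing, so
  -- only the other can be left.
  have uniq (u : ℕ) (hu : u < n) (hfu : (f u, u) ∉ T) (c d : ℕ) (hc : (c, u) ∈ T)
      (hd : (d, u) ∈ T) : c = d := by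
    rcases hdom u hu with hX | ⟨x, hx, hDx, hux⟩
    · exact absurd (hD _ _ hX hc ▸ hc) hfu
    · have hc3 := (mem_box.1 (hbox hc)).1
      have hd3 := (mem_box.1 (hbox hd)).1
      have hu3 := hf.1 u hu
      have hcu : c ≠ f u := fun h => hfu (h ▸ hc)
      have hdu : d ≠ f u := fun h => hfu (h ▸ hd)
      have h1 := hf.2 u hu x hx hux
      obtain ⟨y, hy, h2⟩ := hT c u hu x hx hc hux
      obtain ⟨z, hz, h3⟩ := hT d u hu x hx hd hux
      have hy' := hD _ _ hDx hy
      have hz' := hD _ _ hDx hz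
      have hx3 := hf.1 x hx
      omega
  have hmem (u : ℕ) (hu : u < n) : ((if (f u, u) ∈ T then f u else p u), u) ∈ T := by
    split_ifs with h
    · exact h
    · exact hp u hu
  -- Follow `f` where the lists permit it, and take the only label left elsewhere. On an edge with
  -- an end of the second kind, arc consistency seen from the other end provides a compatible label,
  -- which by `uniq` is the chosen one.
  refine ⟨fun u => if (f u, u) ∈ T then f u else p u,
    ⟨fun v hv => (mem_box.1 (hbox (hmem v hv))).1, fun u hu v hv huv => ?_⟩,
    graphOn_subset_iff.2 hmem⟩
  by_cases h1 : (f u, u) ∈ T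
  · by_cases h2 : (f v, v) ∈ T
    · simp only [h1, h2, if_true]
      exact hf.2 u hu v hv huv
    · obtain ⟨y, hy, hne⟩ := hT _ u hu v hv (hmem u hu) huv
      have := uniq v hv h2 _ _ hy (hmem v hv)
      rwa [this] at hne
  · obtain ⟨y, hy, hne⟩ := hT _ v hv u hu (hmem v hv) (hA u hu v hv huv)
    have := uniq u hu h1 _ _ hy (hmem u hu)
    rw [this] at hne
    rw [add_comm]
    exact hne

/-- `T'` arises from `T` by removing labels that are in no arc consistent sublists, and if no label
was removed, then `R T` holds. -/
def Prunes (n : ℕ) (A : ℕ → ℕ → Prop) (R : Finset (ℕ × ℕ) → Prop) (T T' : Finset (ℕ × ℕ)) :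
    Prop :=
  T' ⊆ T ∧ (∀ Q, IsClosed n A Q → Q ⊆ T → Q ⊆ T') ∧ (T' = T → R T)

/-- If nothing is removed in total, the inclusions `T'' ⊆ T' ⊆ T` collapse, so both conditions hold
for the same lists. -/
theorem Prunes.trans {R R' : Finset (ℕ × ℕ) → Prop} {T T' T'' : Finset (ℕ × ℕ)}
    (h : Prunes n A R T T') (h' : Prunes n A R' T' T'') :
    Prunes n A (fun T => R T ∧ R' T) T T'' := by
  refine ⟨h'.1.trans h.1, fun Q hQ hT => h'.2.1 Q hQ (h.2.1 Q hQ hT), ?_⟩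
  rintro rfl
  have e := h.1.antisymm h'.1
  subst e
  exact ⟨h.2.2 rfl, h'.2.2 rfl⟩

theorem Prunes.mono {R R' : Finset (ℕ × ℕ) → Prop} {T T' : Finset (ℕ × ℕ)}
    (h : Prunes n A R T T') (hR : ∀ T, R T → R' T) : Prunes n A R' T T' :=
  ⟨h.1, h.2.1, fun e => hR _ (h.2.2 e)⟩

theorem Prunes.refl {R : Finset (ℕ × ℕ) → Prop} (T : Finset (ℕ × ℕ)) (h : R T) :
    Prunes n A R T T :=
  ⟨Subset.rfl, fun _ _ h => h, fun _ => h⟩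

/-- Label `c` of vertex `u` has a compatible label at `v`. -/
def Supported (c u v : ℕ) (T : Finset (ℕ × ℕ)) : Prop :=
  (c, u) ∈ T → ∃ y, (y, v) ∈ T ∧ c + y ≠ 2

/-- A closed `Q ⊆ T` containing `(c, u)` would contain a support at `v`, which `T` lacks. If the
deletion changes nothing, then `(c, u)` was absent and is supported vacuously. -/
theorem prunes_erase {c u v : ℕ} (hu : u < n) (hv : v < n) (hA : A u v)
    (h : ¬ ∃ y, (y, v) ∈ T ∧ c + y ≠ 2) : Prunes n A (Supported c u v) T (T.erase (c, u)) := by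
  refine ⟨erase_subset _ _, fun Q hQ hQT q hq => mem_erase.2 ⟨?_, hQT hq⟩, fun e hc => ?_⟩
  · rintro rfl
    obtain ⟨y, hy, hne⟩ := hQ c u hu v hv hq hA
    exact h ⟨y, hQT hy, hne⟩
  · rw [← e] at hc
    simp at hc

/-- `T'` is the largest arc consistent part of `T`. -/
def IsCore (n : ℕ) (A : ℕ → ℕ → Prop) (T T' : Finset (ℕ × ℕ)) : Prop :=
  T' ⊆ T ∧ IsClosed n A T' ∧ ∀ Q, IsClosed n A Q → Q ⊆ T → Q ⊆ T'

theorem IsCore.graphOn_subset {T' : Finset (ℕ × ℕ)} (h : IsCore n A T T') (hg : IsLabelling n A g)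
    (hT : graphOn n g ⊆ T) : graphOn n g ⊆ T' :=
  h.2.2 _ hg.isClosed_graphOn hT

/-- After attempting to remove label `c` from the list of `v` and propagating, the lists `L`
become `L'`. -/
def IsTrial (n : ℕ) (A : ℕ → ℕ → Prop) (c v : ℕ) (L L' : Finset (ℕ × ℕ)) : Prop :=
  ∃ T, IsCore n A (L.erase (c, v)) T ∧ (IsFull n T ∧ L' = T ∨ ¬ IsFull n T ∧ L' = L)

theorem IsTrial.subset {c v : ℕ} {L L' : Finset (ℕ × ℕ)} (h : IsTrial n A c v L L') : L' ⊆ L := by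
  obtain ⟨T, hT, ⟨-, rfl⟩ | ⟨-, rfl⟩⟩ := h
  · exact hT.1.trans (erase_subset _ _)
  · exact Subset.rfl

/-- The lists `L` contain a labelling, and for each pair `(c, v)` in `S`, if `L` still contains this
pair, then all labellings in `L` give the label `c` to `v`. -/
def IsDecidedOn (n : ℕ) (A : ℕ → ℕ → Prop) (S : ℕ → ℕ → Prop) (L : Finset (ℕ × ℕ)) : Prop :=
  (∃ g, IsLabelling n A g ∧ graphOn n g ⊆ L) ∧
    ∀ c v, S c v → (c, v) ∈ L → ∀ g, IsLabelling n A g → graphOn n g ⊆ L → g v = c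

/-- If propagation empties a list, no labelling in `L` avoids label `c` at `v`; otherwise the
smaller lists still contain a labelling. The latter needs only that `f` agrees with the lists on
`D`, not that `f` itself survives in them, so one fixed `f` serves for all trials. -/
theorem IsTrial.isDecidedOn {c v : ℕ} {L L' : Finset (ℕ × ℕ)} {S : ℕ → ℕ → Prop}
    (h : IsTrial n A c v L L') (hL : IsDecidedOn n A S L) (hv : v < n) (hbox : L ⊆ box n)
    (hA : ∀ u < n, ∀ v < n, A u v → A v u) (hf : IsLabelling n A f) {D : ℕ → Prop}
    (hdom : ∀ v < n, D v ∨ ∃ x < n, D x ∧ A v x)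
    (hD : ∀ c x, D x → (c, x) ∈ L → c = f x) :
    IsDecidedOn n A (fun d w => S d w ∨ (d = c ∧ w = v)) L' := by
  obtain ⟨T, hT, ⟨hfull, rfl⟩ | ⟨hfull, rfl⟩⟩ := h
  · have hsub : L' ⊆ L := hT.1.trans (erase_subset _ _)
    refine ⟨hT.2.1.exists_isLabelling hfull (hsub.trans hbox) hA hf hdom
      fun c x hx h => hD c x hx (hsub h), ?_⟩
    rintro d w (hS | ⟨rfl, rfl⟩) hm g hg hgL
    · exact hL.2 d w hS (hsub hm) g hg (hgL.trans hsub)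
    · exact absurd (hT.1 hm) (by simp)
  · refine ⟨hL.1, ?_⟩
    rintro d w (hS | ⟨rfl, rfl⟩) hm g hg hgL
    · exact hL.2 d w hS hm g hg hgL
    · by_contra hne
      refine hfull ((isFull_graphOn n g).mono (hT.graphOn_subset hg ?_))
      rw [graphOn_subset_iff] at hgL ⊢
      refine fun u hu => mem_erase.2 ⟨fun h => ?_, hgL u hu⟩
      simp only [Prod.mk.injEq] at h
      obtain ⟨h1, rfl⟩ := h
      exact hne h1

end Separation

/-! ### Arc consistency on the machine -/

namespace Separation

open Finset RAM RAM.LoopProgram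

/-- The lists of labels stored in the arrays `b`, `b + 1`, `b + 2`. -/
def lists (n b : ℕ) (s : State) : Finset (ℕ × ℕ) := (box n).filter fun p => s.arr (b + p.1) p.2 ≠ 0

theorem mem_lists {n b : ℕ} {s : State} {c v : ℕ} :
    (c, v) ∈ lists n b s ↔ c < 3 ∧ v < n ∧ s.arr (b + c) v ≠ 0 := by
  simp [lists, mem_box, and_assoc]

theorem lists_subset_box (n b : ℕ) (s : State) : lists n b s ⊆ box n := filter_subset _ _

theorem lists_congr {n b : ℕ} {s s' : State} (h : ∀ c < 3, s'.arr (b + c) = s.arr (b + c)) :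
    lists n b s' = lists n b s := by
  ext ⟨c, v⟩
  simp only [mem_lists]
  constructor
  · rintro ⟨hc, hv, h'⟩
    exact ⟨hc, hv, h c hc ▸ h'⟩
  · rintro ⟨hc, hv, h'⟩
    exact ⟨hc, hv, (h c hc).symm ▸ h'⟩

@[simp] theorem lists_setVar (n b : ℕ) (s : State) (x m : ℕ) :
    lists n b (s.setVar x m) = lists n b s := rfl

theorem lists_setArr_zero {n b : ℕ} (s : State) (c v : ℕ) :
    lists n b (s.setArr (b + c) v 0) = (lists n b s).erase (c, v) := by
  ext ⟨d, w⟩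
  simp only [mem_lists, mem_erase, State.setArr_arr, ne_eq, Prod.mk.injEq, Nat.add_left_cancel_iff]
  by_cases h : d = c ∧ w = v
  · simp [h]
  · simp [h]

/-- The adjacency relation stored row by row in `M`. -/
def rowAdj (n : ℕ) (M : ℕ → ℕ) (u v : ℕ) : Prop := M (u * n + v) = 1

/-- Delete label `c` from the list of vertex `var 9` if the labels `y`, `z` are not in the list of
vertex `var 10`. -/
def prune (c y z : ℕ) : LoopProgram :=
  cond (.eq (.get (10 + y) (.var 10)) (.const 0))
    (cond (.eq (.get (10 + z) (.var 10)) (.const 0)) (store (10 + c) (.var 9) (.const 0)) skip)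
    skip

/-- The hypothesis `hc` says that `y` and `z` are exactly the labels compatible with `c`, so looking
at two cells decides whether there is a support. -/
theorem prunes_prune {n : ℕ} {A : ℕ → ℕ → Prop} {c y z : ℕ} (hc : ∀ k < 3, c + k ≠ 2 ↔ k = y ∨ k = z)
    (hy : y < 3) (hz : z < 3) (s : State) (hu : s.var 9 < n) (hv : s.var 10 < n)
    (hA : A (s.var 9) (s.var 10)) :
    Prunes n A (Supported c (s.var 9) (s.var 10)) (lists n 10 s)
      (lists n 10 ((prune c y z).eval s)) := by
  have hyc := (hc y hy).2 (.inl rfl)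
  have hzc := (hc z hz).2 (.inr rfl)
  simp only [prune, eval_store, eval_skip, eval_cond_eq, select_eq_ite, Expr.value]
  by_cases h1 : s.arr (10 + y) (s.var 10) = 0
  swap
  · rw [if_neg h1]
    exact .refl _ fun _ => ⟨y, mem_lists.2 ⟨hy, hv, h1⟩, hyc⟩
  rw [if_pos h1]
  by_cases h2 : s.arr (10 + z) (s.var 10) = 0
  swap
  · rw [if_neg h2]
    exact .refl _ fun _ => ⟨z, mem_lists.2 ⟨hz, hv, h2⟩, hzc⟩
  · rw [if_pos h2, lists_setArr_zero]
    refine prunes_erase hu hv hA ?_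
    rintro ⟨k, hk, hne⟩
    obtain ⟨hk3, -, hk⟩ := mem_lists.1 hk
    rcases (hc k hk3).1 hne with rfl | rfl
    · exact hk h1
    · exact hk h2

/-- Make the list of vertex `var 9` consistent with the list of vertex `var 10`. -/
def pruneEdge : LoopProgram := seq (prune 0 0 1) (seq (prune 1 0 2) (prune 2 1 2))

theorem prunes_pruneEdge {n : ℕ} {A : ℕ → ℕ → Prop} (s : State) (hu : s.var 9 < n)
    (hv : s.var 10 < n) (hA : A (s.var 9) (s.var 10)) :
    Prunes n A (fun T => ∀ c < 3, Supported c (s.var 9) (s.var 10) T) (lists n 10 s)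
      (lists n 10 (pruneEdge.eval s)) := by
  have e9 (c y z : ℕ) (r : State) : ((prune c y z).eval r).var 9 = r.var 9 :=
    eval_var_of_not_writesVar _ rfl _
  have e10 (c y z : ℕ) (r : State) : ((prune c y z).eval r).var 10 = r.var 10 :=
    eval_var_of_not_writesVar _ rfl _
  have h0 := prunes_prune (n := n) (A := A) (c := 0) (y := 0) (z := 1) (by omega) (by omega)
    (by omega) s hu hv hA
  have h1 := prunes_prune (n := n) (A := A) (c := 1) (y := 0) (z := 2) (by omega) (by omega)
    (by omega) ((prune 0 0 1).eval s) (by rwa [e9]) (by rwa [e10]) (by rwa [e9, e10])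
  have h2 := prunes_prune (n := n) (A := A) (c := 2) (y := 1) (z := 2) (by omega) (by omega)
    (by omega) ((prune 1 0 2).eval ((prune 0 0 1).eval s)) (by rwa [e9, e9]) (by rwa [e10, e10])
    (by rwa [e9, e10, e9, e10])
  simp only [e9, e10] at h1 h2
  refine (h0.trans (h1.trans h2)).mono ?_
  rintro T ⟨ha, hb, hc⟩ c hc3
  interval_cases c
  · exact ha
  · exact hb
  · exact hc

/-- The inner loop of `sweep`, for one vertex `var 9` and all its neighbours. -/
def sweepRow : LoopProgram :=
  forLoop 10 (seq (cond (.eq (.get 0 (.var 11)) (.const 1)) pruneEdge skip)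
    (assign 11 (.succ (.var 11))))

/-- Prune once along every edge. -/
def sweep : LoopProgram := seq (assign 11 (.const 0)) (forLoop 9 sweepRow)

/-- The machine cannot multiply, so register 11 is advanced in step with the matrix entries and
always holds the address `u * n + v`. -/
theorem sweepRow_spec (s : State) (hu : s.var 9 < s.var 0)
    (h11 : s.var 11 = s.var 9 * s.var 0) :
    (sweepRow.eval s).var 11 = (s.var 9 + 1) * s.var 0 ∧
    Prunes (s.var 0) (rowAdj (s.var 0) (s.arr 0))
      (fun T => ∀ v < s.var 0, rowAdj (s.var 0) (s.arr 0) (s.var 9) v →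
        ∀ c < 3, Supported c (s.var 9) v T)
      (lists (s.var 0) 10 s) (lists (s.var 0) 10 (sweepRow.eval s)) := by
  have := eval_forLoop_induction (x := 10)
    (P := seq (cond (.eq (.get 0 (.var 11)) (.const 1)) pruneEdge skip)
      (assign 11 (.succ (.var 11)))) s rfl
    (fun i r => r.var 11 = s.var 9 * s.var 0 + i ∧
      Prunes (s.var 0) (rowAdj (s.var 0) (s.arr 0))
        (fun T => ∀ v < i, rowAdj (s.var 0) (s.arr 0) (s.var 9) v →
          ∀ c < 3, Supported c (s.var 9) v T)
        (lists (s.var 0) 10 s) (lists (s.var 0) 10 r))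
    ⟨by simp [State.setVar_var, h11], .refl _ fun v hv => absurd hv (Nat.not_lt_zero v)⟩ ?_
  · rw [add_mul, one_mul]
    exact this
  · intro i r hi h10 hvar harr ⟨hr, hP⟩
    have h9 := hvar 9 rfl
    have hM := harr 0 rfl
    simp only [eval_seq, eval_assign, eval_skip, eval_cond_eq, select_eq_ite, Expr.value, lists_setVar]
    rw [hM, hr]
    by_cases hadj : s.arr 0 (s.var 9 * s.var 0 + i) = 1
    · have e11 : (pruneEdge.eval r).var 11 = r.var 11 := eval_var_of_not_writesVar _ rfl _
      rw [if_pos hadj]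
      refine ⟨by simp [State.setVar_var, e11, hr, add_assoc], ?_⟩
      have hE := prunes_pruneEdge (n := s.var 0) (A := rowAdj (s.var 0) (s.arr 0)) r
        (by omega) (by omega) (by rw [h9, h10]; exact hadj)
      rw [h9, h10] at hE
      refine (hP.trans hE).mono ?_
      rintro T ⟨h1, h2⟩ v hv hA
      rcases Nat.lt_succ_iff_lt_or_eq.1 hv with hv | rfl
      · exact h1 v hv hA
      · exact h2
    · rw [if_neg hadj]
      refine ⟨by simp [State.setVar_var, hr, add_assoc], hP.mono ?_⟩
      intro T h1 v hv hA
      rcases Nat.lt_succ_iff_lt_or_eq.1 hv with hv | rfl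
      · exact h1 v hv hA
      · exact absurd hA hadj

/-- Later deletions may destroy supports checked earlier, so one sweep need not reach consistency; a
sweep without effect certifies it. -/
theorem sweep_spec (s : State) :
    Prunes (s.var 0) (rowAdj (s.var 0) (s.arr 0)) (fun T => T ⊆ box (s.var 0) →
      IsClosed (s.var 0) (rowAdj (s.var 0) (s.arr 0)) T)
      (lists (s.var 0) 10 s) (lists (s.var 0) 10 (sweep.eval s)) := by
  have := eval_forLoop_induction (x := 9) (P := sweepRow) (s.setVar 11 0) rfl
    (fun i r => r.var 11 = i * s.var 0 ∧
      Prunes (s.var 0) (rowAdj (s.var 0) (s.arr 0))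
        (fun T => ∀ u < i, ∀ v < s.var 0, rowAdj (s.var 0) (s.arr 0) u v →
          ∀ c < 3, Supported c u v T)
        (lists (s.var 0) 10 s) (lists (s.var 0) 10 r))
    ⟨by simp [State.setVar_var], .refl _ fun v hv => absurd hv (Nat.not_lt_zero v)⟩ ?_
  · refine this.2.mono ?_
    intro T hT hbox c u hu v hv hc hA
    exact hT u hu v hv hA c (mem_box.1 (hbox hc)).1 hc
  · intro i r hi h9 hvar harr ⟨hr, hP⟩
    have h0 : r.var 0 = s.var 0 := hvar 0 rfl
    have hM : r.arr 0 = s.arr 0 := harr 0 rfl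
    obtain ⟨e11, hE⟩ := sweepRow_spec r (by rw [h9, h0]; exact hi) (by rw [hr, h9, h0])
    rw [h9, h0] at e11 hE
    rw [hM] at hE
    refine ⟨by simpa [State.setVar_var] using e11, (hP.trans hE).mono ?_⟩
    rintro T ⟨h1, h2⟩ u hu
    rcases Nat.lt_succ_iff_lt_or_eq.1 hu with hu | rfl
    · exact h1 u hu
    · exact h2

/-- Propagation: `3 n` sweeps. -/
def propagate : LoopProgram := forLoop 8 (seq sweep (seq sweep sweep))

/-- `T'` is a part of `T` with the same closed sublists, and is closed or small. -/
def IsPartialCore (n : ℕ) (A : ℕ → ℕ → Prop) (m : ℕ) (T T' : Finset (ℕ × ℕ)) : Prop :=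
  T' ⊆ T ∧ (∀ Q, IsClosed n A Q → Q ⊆ T → Q ⊆ T') ∧ (IsClosed n A T' ∨ T'.card + m ≤ 3 * n)

/-- A sweep with an effect removes at least one pair. On lists that are already closed it has none,
since it keeps every closed part of them. -/
theorem IsPartialCore.sweep {m : ℕ} {T : Finset (ℕ × ℕ)} {s r : State} (h0 : r.var 0 = s.var 0)
    (hM : r.arr 0 = s.arr 0)
    (h : IsPartialCore (s.var 0) (rowAdj (s.var 0) (s.arr 0)) m T (lists (s.var 0) 10 r)) :
    IsPartialCore (s.var 0) (rowAdj (s.var 0) (s.arr 0)) (m + 1) T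
      (lists (s.var 0) 10 (sweep.eval r)) := by
  have hS := sweep_spec r
  rw [h0, hM] at hS
  refine ⟨hS.1.trans h.1, fun Q hQ hQT => hS.2.1 Q hQ (h.2.1 Q hQ hQT), ?_⟩
  by_cases e : lists (s.var 0) 10 (Separation.sweep.eval r) = lists (s.var 0) 10 r
  · left
    rw [e]
    exact hS.2.2 e (lists_subset_box _ _ _)
  · rcases h.2.2 with hcl | hcard
    · exact absurd (hS.1.antisymm (hS.2.1 _ hcl Subset.rfl)) e
    · right
      have := card_lt_card (hS.1.ssubset_of_ne e)
      omega

theorem propagate_spec (s : State) :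
    IsCore (s.var 0) (rowAdj (s.var 0) (s.arr 0)) (lists (s.var 0) 10 s)
      (lists (s.var 0) 10 (propagate.eval s)) := by
  have := eval_forLoop_induction (x := 8) (P := seq sweep (seq sweep sweep)) s rfl
    (fun i r => IsPartialCore (s.var 0) (rowAdj (s.var 0) (s.arr 0)) (3 * i)
      (lists (s.var 0) 10 s) (lists (s.var 0) 10 r))
    ⟨Subset.rfl, fun _ _ h => h, .inr ?_⟩ ?_
  · refine ⟨this.1, ?_, this.2.1⟩
    -- After `n` rounds of three sweeps, the second alternative leaves no pair at all, and the empty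
    -- set is closed.
    rcases this.2.2 with h | h
    · exact h
    · have h0 : (lists (s.var 0) 10 (propagate.eval s)).card = 0 := by
        simp only [propagate]
        omega
      rw [card_eq_zero] at h0
      rw [h0]
      intro c u hu v hv hc
      simp at hc
  · rw [lists_setVar]
    exact (card_le_card (lists_subset_box _ _ _)).trans (card_box _).le
  · intro i r hi h8 hvar harr hI
    have h0 : r.var 0 = s.var 0 := hvar 0 rfl
    have hM : r.arr 0 = s.arr 0 := harr 0 rfl
    have e0 (q : State) : (sweep.eval q).var 0 = q.var 0 := eval_var_of_not_writesVar _ rfl _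
    have eM (q : State) : (sweep.eval q).arr 0 = q.arr 0 := eval_arr_of_not_writesArr _ rfl _
    exact ((hI.sweep h0 hM).sweep (by rw [e0, h0]) (by rw [eM, hM])).sweep
      (by rw [e0, e0, h0]) (by rw [eM, eM, hM])

/-- Set register `12` to `1` if all lists are nonempty and to `0` otherwise. -/
def checkFull : LoopProgram :=
  seq (assign 12 (.const 1)) (forLoop 10
    (cond (.eq (.get 10 (.var 10)) (.const 0))
      (cond (.eq (.get 11 (.var 10)) (.const 0))
        (cond (.eq (.get 12 (.var 10)) (.const 0)) (assign 12 (.const 0)) skip) skip) skip))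

theorem isFull_lists {n b : ℕ} {s : State} : IsFull n (lists n b s) ↔
    ∀ v < n, ¬ (s.arr b v = 0 ∧ s.arr (b + 1) v = 0 ∧ s.arr (b + 2) v = 0) := by
  refine forall₂_congr fun v hv => ⟨?_, fun h => ?_⟩
  · rintro ⟨c, hc⟩ ⟨h0, h1, h2⟩
    obtain ⟨hc3, -, hc⟩ := mem_lists.1 hc
    interval_cases c
    · exact hc h0
    · exact hc h1
    · exact hc h2
  · simp only [mem_lists]
    by_contra! hcon
    exact h ⟨hcon 0 (by omega) hv, hcon 1 (by omega) hv, hcon 2 (by omega) hv⟩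

theorem checkFull_spec (s : State) :
    (checkFull.eval s).var 12 = 1 ∧ IsFull (s.var 0) (lists (s.var 0) 10 s) ∨
      (checkFull.eval s).var 12 = 0 ∧ ¬ IsFull (s.var 0) (lists (s.var 0) 10 s) := by
  rw [isFull_lists]
  have := eval_forLoop_induction (x := 10)
    (P := cond (.eq (.get 10 (.var 10)) (.const 0))
      (cond (.eq (.get 11 (.var 10)) (.const 0))
        (cond (.eq (.get 12 (.var 10)) (.const 0)) (assign 12 (.const 0)) skip) skip) skip)
    (s.setVar 12 1) rfl
    (fun i r => r.var 12 = 1 ∧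
        (∀ v < i, ¬ (s.arr 10 v = 0 ∧ s.arr 11 v = 0 ∧ s.arr 12 v = 0)) ∨
      r.var 12 = 0 ∧ ¬ (∀ v < i, ¬ (s.arr 10 v = 0 ∧ s.arr 11 v = 0 ∧ s.arr 12 v = 0)))
    (.inl ⟨by simp [State.setVar_var], fun v hv => absurd hv (Nat.not_lt_zero v)⟩) ?_
  · exact this
  · intro i r hi h10 hvar harr hI
    have e0 : r.arr 10 = s.arr 10 := harr 10 rfl
    have e1 : r.arr 11 = s.arr 11 := harr 11 rfl
    have e2 : r.arr 12 = s.arr 12 := harr 12 rfl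
    simp only [eval_assign, eval_skip, eval_cond_eq, select_eq_ite, Expr.value, e0, e1, e2, h10, Nat.forall_lt_succ_right]
    split_ifs with h0 h1 h2
    · simp [State.setVar_var, h0, h1, h2]
    all_goals simp [State.setVar_var, *]
    all_goals simpa using hI

end Separation

/-! ### Trial deletions, thinning and initial lists -/

namespace Separation

open Finset RAM RAM.LoopProgram

/-- Copy the lists in the arrays from `b` on to the arrays from `d` on. -/
def copyLists (b d : ℕ) : LoopProgram :=
  forLoop 10 (seq (store d (.var 10) (.get b (.var 10)))
    (seq (store (d + 1) (.var 10) (.get (b + 1) (.var 10)))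
      (store (d + 2) (.var 10) (.get (b + 2) (.var 10)))))

theorem copyLists_spec {b d : ℕ} (hbd : b + 3 ≤ d ∨ d + 3 ≤ b) (s : State) :
    lists (s.var 0) d ((copyLists b d).eval s) = lists (s.var 0) b s := by
  have := eval_forLoop_induction (x := 10)
    (P := seq (store d (.var 10) (.get b (.var 10)))
      (seq (store (d + 1) (.var 10) (.get (b + 1) (.var 10)))
        (store (d + 2) (.var 10) (.get (b + 2) (.var 10))))) s rfl
    (fun i r => ∀ w < i, ∀ c < 3, r.arr (d + c) w = s.arr (b + c) w)
    (fun w hw => absurd hw (Nat.not_lt_zero w)) ?_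
  · ext ⟨c, v⟩
    simp only [mem_lists]
    constructor
    · rintro ⟨hc, hv, h⟩
      exact ⟨hc, hv, this v hv c hc ▸ h⟩
    · rintro ⟨hc, hv, h⟩
      exact ⟨hc, hv, (this v hv c hc).symm ▸ h⟩
  · intro i r hi h10 hvar harr hI w hw c hc
    have e (k : ℕ) (hk : k < 3) : r.arr (b + k) = s.arr (b + k) :=
      harr _ (by simp [writesArr]; omega)
    have e0 := e 0 (by omega)
    have e1 := e 1 (by omega)
    have e2 := e 2 (by omega)
    simp only [add_zero] at e0
    have n1 : b + 1 ≠ d := by omega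
    have n2 : b + 2 ≠ d := by omega
    have n3 : b + 2 ≠ d + 1 := by omega
    simp only [eval_seq, eval_store, Expr.value, State.setVar_arr, State.setArr_var,
      State.setArr_arr, h10, e0, e1, e2, n1, n2, n3, false_and, if_false]
    rcases Nat.lt_succ_iff_lt_or_eq.1 hw with hw | rfl
    · have := hw.ne
      simp [this, hI w hw c hc]
    · interval_cases c <;> simp

/-- Try to remove label `c` from the list of vertex `var 7`. -/
def trial (c : ℕ) : LoopProgram :=
  seq (copyLists 20 10) (seq (store (10 + c) (.var 7) (.const 0)) (seq propagate (seq checkFull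
    (cond (.eq (.var 12) (.const 1)) (copyLists 10 20) skip))))

/-- The deletion and the propagation act on a copy in the arrays from 10 on. The lists in the arrays
from 20 on are overwritten only upon success, so a failed trial needs no undoing. -/
theorem trial_spec (s : State) {c : ℕ} (hc : c < 3) :
    IsTrial (s.var 0) (rowAdj (s.var 0) (s.arr 0)) c (s.var 7) (lists (s.var 0) 20 s)
      (lists (s.var 0) 20 ((trial c).eval s)) := by
  set s₁ := (copyLists 20 10).eval s with hs₁
  set s₂ := s₁.setArr (10 + c) (s₁.var 7) 0 with hs₂
  set s₃ := propagate.eval s₂ with hs₃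
  set s₄ := checkFull.eval s₃ with hs₄
  have v1 : s₁.var 0 = s.var 0 := eval_var_of_not_writesVar _ rfl _
  have v17 : s₁.var 7 = s.var 7 := eval_var_of_not_writesVar _ rfl _
  have v2 : s₂.var 0 = s.var 0 := v1
  have v3 : s₃.var 0 = s.var 0 := (eval_var_of_not_writesVar _ rfl _).trans v2
  have v4 : s₄.var 0 = s.var 0 := (eval_var_of_not_writesVar _ rfl _).trans v3
  have m1 : s₁.arr 0 = s.arr 0 := eval_arr_of_not_writesArr _ rfl _
  have m2 : s₂.arr 0 = s.arr 0 := by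
    rw [← m1]
    ext j
    rw [hs₂, State.setArr_arr, if_neg (by omega)]
  have t4 : lists (s.var 0) 10 s₄ = lists (s.var 0) 10 s₃ :=
    lists_congr fun k hk => eval_arr_of_not_writesArr _ rfl _
  have l4 : lists (s.var 0) 20 s₄ = lists (s.var 0) 20 s := by
    refine lists_congr fun k hk => ?_
    have a4 : s₄.arr (20 + k) = s₃.arr (20 + k) := eval_arr_of_not_writesArr _ rfl _
    have a3 : s₃.arr (20 + k) = s₂.arr (20 + k) :=
      eval_arr_of_not_writesArr _ (by interval_cases k <;> rfl) _
    have a2 : s₂.arr (20 + k) = s₁.arr (20 + k) := by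
      ext j
      rw [hs₂, State.setArr_arr, if_neg (by omega)]
    have a1 : s₁.arr (20 + k) = s.arr (20 + k) :=
      eval_arr_of_not_writesArr _ (by interval_cases k <;> rfl) _
    rw [a4, a3, a2, a1]
  have hcore := propagate_spec s₂
  have hfull := checkFull_spec s₃
  have t1 : lists (s.var 0) 10 s₁ = lists (s.var 0) 20 s := copyLists_spec (by omega) s
  have t2 : lists (s.var 0) 10 s₂ = (lists (s.var 0) 20 s).erase (c, s.var 7) := by
    rw [hs₂, lists_setArr_zero, v17, t1]
  rw [v2, m2, ← hs₃, t2] at hcore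
  rw [v3] at hfull
  have he : (trial c).eval s = select (s₄.var 12) 1 ((copyLists 10 20).eval s₄) s₄ := rfl
  rw [he, select_eq_ite]
  refine ⟨_, hcore, ?_⟩
  rcases hfull with ⟨h1, h2⟩ | ⟨h1, h2⟩
  · refine .inl ⟨h2, ?_⟩
    rw [if_pos h1, ← t4, ← v4]
    exact copyLists_spec (by omega) s₄
  · refine .inr ⟨h2, ?_⟩
    rw [if_neg (by rw [h1]; omega), l4]

/-- Try to remove every label of every vertex. -/
def decideAll : LoopProgram := forLoop 7 (seq (trial 0) (seq (trial 1) (trial 2)))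

/-- The inclusion holds in any case and serves soundness. Only the second part presupposes a
labelling `f`, which the program does not know; hence `f` and `D` are quantified in the conclusion.
-/
theorem decideAll_spec (s : State) :
    lists (s.var 0) 20 (decideAll.eval s) ⊆ lists (s.var 0) 20 s ∧
    ∀ (f : ℕ → ℕ) (D : ℕ → Prop),
      (∀ u < s.var 0, ∀ v < s.var 0, rowAdj (s.var 0) (s.arr 0) u v →
        rowAdj (s.var 0) (s.arr 0) v u) →
      IsLabelling (s.var 0) (rowAdj (s.var 0) (s.arr 0)) f →
      (∀ v < s.var 0, D v ∨ ∃ x < s.var 0, D x ∧ rowAdj (s.var 0) (s.arr 0) v x) →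
      (∀ c x, D x → (c, x) ∈ lists (s.var 0) 20 s → c = f x) →
      graphOn (s.var 0) f ⊆ lists (s.var 0) 20 s →
      IsDecidedOn (s.var 0) (rowAdj (s.var 0) (s.arr 0)) (fun c v => v < s.var 0 ∧ c < 3)
        (lists (s.var 0) 20 (decideAll.eval s)) := by
  have := eval_forLoop_induction (x := 7) (P := seq (trial 0) (seq (trial 1) (trial 2))) s rfl
    (fun i r => lists (s.var 0) 20 r ⊆ lists (s.var 0) 20 s ∧
    ∀ (f : ℕ → ℕ) (D : ℕ → Prop),
      (∀ u < s.var 0, ∀ v < s.var 0, rowAdj (s.var 0) (s.arr 0) u v →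
        rowAdj (s.var 0) (s.arr 0) v u) →
      IsLabelling (s.var 0) (rowAdj (s.var 0) (s.arr 0)) f →
      (∀ v < s.var 0, D v ∨ ∃ x < s.var 0, D x ∧ rowAdj (s.var 0) (s.arr 0) v x) →
      (∀ c x, D x → (c, x) ∈ lists (s.var 0) 20 s → c = f x) →
      graphOn (s.var 0) f ⊆ lists (s.var 0) 20 s →
      IsDecidedOn (s.var 0) (rowAdj (s.var 0) (s.arr 0)) (fun c v => v < i ∧ c < 3)
        (lists (s.var 0) 20 r))
    ⟨Subset.rfl, fun f D _ hf _ _ hfs => ⟨⟨f, hf, hfs⟩, fun c v h => absurd h.1 (by omega)⟩⟩ ?_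
  · exact this
  · intro i r hi h7 hvar harr hI
    have h0 : r.var 0 = s.var 0 := hvar 0 rfl
    have hM : r.arr 0 = s.arr 0 := harr 0 rfl
    have e0 (q : State) (c : ℕ) : ((trial c).eval q).var 0 = q.var 0 :=
      eval_var_of_not_writesVar _ rfl _
    have e7 (q : State) (c : ℕ) : ((trial c).eval q).var 7 = q.var 7 :=
      eval_var_of_not_writesVar _ rfl _
    have eM (q : State) {c : ℕ} (hc : c < 3) : ((trial c).eval q).arr 0 = q.arr 0 :=
      eval_arr_of_not_writesArr _ (by interval_cases c <;> rfl) _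
    have t0 := trial_spec r (c := 0) (by omega)
    have t1 := trial_spec ((trial 0).eval r) (c := 1) (by omega)
    have t2 := trial_spec ((trial 1).eval ((trial 0).eval r)) (c := 2) (by omega)
    rw [h0, hM, h7] at t0
    rw [e0, h0, eM _ (by omega), hM, e7, h7] at t1
    rw [e0, e0, h0, eM _ (by omega), eM _ (by omega), hM, e7, e7, h7] at t2
    simp only [eval_seq, lists_setVar]
    refine ⟨t2.subset.trans (t1.subset.trans (t0.subset.trans hI.1)), ?_⟩
    intro f D hA hf hdom hD hfs
    have d0 := t0.isDecidedOn (hI.2 f D hA hf hdom hD hfs) hi (lists_subset_box _ _ _) hA hf hdom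
      fun c x hx h => hD c x hx (hI.1 h)
    have d1 := t1.isDecidedOn d0 hi (lists_subset_box _ _ _) hA hf hdom
      fun c x hx h => hD c x hx (hI.1 (t0.subset h))
    have d2 := t2.isDecidedOn d1 hi (lists_subset_box _ _ _) hA hf hdom
      fun c x hx h => hD c x hx (hI.1 (t0.subset (t1.subset h)))
    refine ⟨d2.1, fun c v h => d2.2 c v ?_⟩
    omega

/-- Copy the lists from the arrays from `20` on to the arrays from `10` on, keeping only the
smallest label of each vertex. -/
def thin : LoopProgram :=
  forLoop 10 (cond (.eq (.get 20 (.var 10)) (.const 0))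
    (seq (store 10 (.var 10) (.const 0)) (cond (.eq (.get 21 (.var 10)) (.const 0))
      (seq (store 11 (.var 10) (.const 0)) (store 12 (.var 10) (.get 22 (.var 10))))
      (seq (store 11 (.var 10) (.const 1)) (store 12 (.var 10) (.const 0)))))
    (seq (store 10 (.var 10) (.const 1))
      (seq (store 11 (.var 10) (.const 0)) (store 12 (.var 10) (.const 0)))))

/-- Lists decided everywhere are singletons, and thinning does not change them. When no labelling
exists, it still enforces at most one label per vertex, so that the final check cannot be deceived.
-/
theorem thin_spec (s : State) (c v : ℕ) : (c, v) ∈ lists (s.var 0) 10 (thin.eval s) ↔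
    (c, v) ∈ lists (s.var 0) 20 s ∧ ∀ d < c, (d, v) ∉ lists (s.var 0) 20 s := by
  have := eval_forLoop_induction (x := 10)
    (P := cond (.eq (.get 20 (.var 10)) (.const 0))
    (seq (store 10 (.var 10) (.const 0)) (cond (.eq (.get 21 (.var 10)) (.const 0))
      (seq (store 11 (.var 10) (.const 0)) (store 12 (.var 10) (.get 22 (.var 10))))
      (seq (store 11 (.var 10) (.const 1)) (store 12 (.var 10) (.const 0)))))
    (seq (store 10 (.var 10) (.const 1))
      (seq (store 11 (.var 10) (.const 0)) (store 12 (.var 10) (.const 0))))) s rfl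
    (fun i r => ∀ w < i, (r.arr 10 w ≠ 0 ↔ s.arr 20 w ≠ 0) ∧
      (r.arr 11 w ≠ 0 ↔ s.arr 21 w ≠ 0 ∧ s.arr 20 w = 0) ∧
      (r.arr 12 w ≠ 0 ↔ s.arr 22 w ≠ 0 ∧ s.arr 20 w = 0 ∧ s.arr 21 w = 0))
    (fun w hw => absurd hw (Nat.not_lt_zero w)) ?_
  · simp only [mem_lists]
    by_cases hv : v < s.var 0
    swap
    · simp [hv]
    by_cases hc : c < 3
    swap
    · simp [hc]
    obtain ⟨h0, h1, h2⟩ := this v hv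
    interval_cases c
    · simpa [hv, thin] using h0
    · simpa [hv, thin] using h1
    · simp only [hv, hc, true_and]
      rw [show 10 + 2 = 12 from rfl, thin, h2, Nat.forall_lt_succ_right, Nat.forall_lt_succ_right]
      simp
  · intro i r hi h10 hvar harr hI w hw
    have e0 : r.arr 20 = s.arr 20 := harr 20 rfl
    have e1 : r.arr 21 = s.arr 21 := harr 21 rfl
    have e2 : r.arr 22 = s.arr 22 := harr 22 rfl
    simp only [eval_seq, eval_store, eval_cond_eq, select_eq_ite, Expr.value, State.setVar_arr,
      State.setArr_var, State.setArr_arr, h10, e0, e1, e2]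
    rcases Nat.lt_succ_iff_lt_or_eq.1 hw with hw | rfl
    · have := hw.ne
      split_ifs <;> simpa [State.setArr_arr, this] using hI w hw
    · split_ifs <;> simp_all [State.setArr_arr]

/-- Remove label `c` from the list of vertex `var 10` if `e₁ = e₂` but not `e₃ = e₄`. -/
def exclude (c : ℕ) (e₁ e₂ e₃ e₄ : Expr) : LoopProgram :=
  cond (.eq e₁ e₂) (cond (.eq e₃ e₄) skip (store (20 + c) (.var 10) (.const 0))) skip

theorem exclude_spec (s : State) (c : ℕ) (e₁ e₂ e₃ e₄ : Expr) :
    (((exclude c e₁ e₂ e₃ e₄).eval s).arr (20 + c) (s.var 10) ≠ 0 ↔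
      s.arr (20 + c) (s.var 10) ≠ 0 ∧ (e₁.value s = e₂.value s → e₃.value s = e₄.value s)) ∧
    ((exclude c e₁ e₂ e₃ e₄).eval s).var = s.var ∧
    ∀ d w, ¬ (d = 20 + c ∧ w = s.var 10) →
      ((exclude c e₁ e₂ e₃ e₄).eval s).arr d w = s.arr d w := by
  rw [exclude, eval_cond_eq, eval_cond_eq, eval_store, eval_skip, select_eq_ite, select_eq_ite]
  by_cases h1 : e₁.value s = e₂.value s
  · by_cases h2 : e₃.value s = e₄.value s
    · simp [h1, h2]
    · simp only [h1, h2, if_true, if_false, Expr.value]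
      refine ⟨by simp [State.setArr_arr], rfl, fun d w h => ?_⟩
      rw [State.setArr_arr, if_neg h]
  · simp [h1]

/-- Compute whether vertex `var 10` may have label `c`, given the labels in array `3` of the
vertices in array `1`, label `0` for vertex `var 5` and label `2` for vertex `var 6`. -/
def initLabel (c : ℕ) : LoopProgram :=
  seq (store (20 + c) (.var 10) (.const 1))
    (seq (exclude c (.get 1 (.var 10)) (.const 1) (.get 3 (.var 10)) (.const c))
      (seq (exclude c (.var 10) (.var 5) (.const c) (.const 0))
        (exclude c (.var 10) (.var 6) (.const c) (.const 2))))

/-- Label `c` is allowed initially for vertex `v`. -/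
def Allowed (X col : ℕ → ℕ) (a b c v : ℕ) : Prop :=
  (X v = 1 → col v = c) ∧ (v = a → c = 0) ∧ (v = b → c = 2)

theorem initLabel_spec (s : State) (c : ℕ) :
    (((initLabel c).eval s).arr (20 + c) (s.var 10) ≠ 0 ↔
      Allowed (s.arr 1) (s.arr 3) (s.var 5) (s.var 6) c (s.var 10)) ∧
    ∀ d w, ¬ (d = 20 + c ∧ w = s.var 10) → ((initLabel c).eval s).arr d w = s.arr d w := by
  set s₁ := s.setArr (20 + c) (s.var 10) 1 with hs₁
  have o1 (d w : ℕ) (h : ¬ (d = 20 + c ∧ w = s.var 10)) : s₁.arr d w = s.arr d w := by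
    rw [hs₁, State.setArr_arr, if_neg h]
  have k1 : s₁.arr (20 + c) (s.var 10) ≠ 0 := by
    rw [hs₁, State.setArr_arr, if_pos ⟨rfl, rfl⟩]
    omega
  have w1 : s₁.var = s.var := rfl
  rw [initLabel, eval_seq, eval_seq, eval_seq, eval_store, Expr.value, Expr.value, ← hs₁]
  clear_value s₁
  obtain ⟨k2, w2, o2⟩ := exclude_spec s₁ c (.get 1 (.var 10)) (.const 1) (.get 3 (.var 10))
    (.const c)
  generalize (exclude c (.get 1 (.var 10)) (.const 1) (.get 3 (.var 10)) (.const c)).eval s₁ = s₂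
    at k2 w2 o2 ⊢
  obtain ⟨k3, w3, o3⟩ := exclude_spec s₂ c (.var 10) (.var 5) (.const c) (.const 0)
  generalize (exclude c (.var 10) (.var 5) (.const c) (.const 0)).eval s₂ = s₃ at k3 w3 o3 ⊢
  obtain ⟨k4, w4, o4⟩ := exclude_spec s₃ c (.var 10) (.var 6) (.const c) (.const 2)
  generalize (exclude c (.var 10) (.var 6) (.const c) (.const 2)).eval s₃ = s₄ at k4 w4 o4 ⊢
  simp only [Expr.value, w3, w2, w1] at k2 k3 k4 o2 o3 o4
  have x1 := o1 1 (s.var 10) (by omega)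
  have x3 := o1 3 (s.var 10) (by omega)
  rw [x1, x3] at k2
  refine ⟨?_, fun d w h => (o4 d w h).trans ((o3 d w h).trans ((o2 d w h).trans (o1 d w h)))⟩
  rw [k4, k3, k2, Allowed]
  simp only [k1, ne_eq, not_false_eq_true, true_and, and_assoc]

/-- Compute the initial lists. -/
def init : LoopProgram := forLoop 10 (seq (initLabel 0) (seq (initLabel 1) (initLabel 2)))

theorem init_spec (s : State) (c v : ℕ) : (c, v) ∈ lists (s.var 0) 20 (init.eval s) ↔
    c < 3 ∧ v < s.var 0 ∧ Allowed (s.arr 1) (s.arr 3) (s.var 5) (s.var 6) c v := by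
  have := eval_forLoop_induction (x := 10)
    (P := seq (initLabel 0) (seq (initLabel 1) (initLabel 2))) s rfl
    (fun i r => ∀ w < i, ∀ c < 3, r.arr (20 + c) w ≠ 0 ↔
      Allowed (s.arr 1) (s.arr 3) (s.var 5) (s.var 6) c w)
    (fun w hw => absurd hw (Nat.not_lt_zero w)) ?_
  · rw [mem_lists]
    exact and_congr_right fun hc => and_congr_right fun hv => this v hv c hc
  · intro i r hi h10 hvar harr hI w hw c hc
    have v5 : r.var 5 = s.var 5 := hvar 5 rfl
    have v6 : r.var 6 = s.var 6 := hvar 6 rfl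
    have a1 : r.arr 1 = s.arr 1 := harr 1 rfl
    have a3 : r.arr 3 = s.arr 3 := harr 3 rfl
    have e (x : ℕ) (d : ℕ) (q : State) : ((initLabel d).eval q).var x = q.var x :=
      eval_var_of_not_writesVar _ rfl _
    have e1 (q : State) {d : ℕ} : ((initLabel d).eval q).arr 1 = q.arr 1 := by
      ext j
      exact (initLabel_spec q d).2 1 j (by omega)
    have e3 (q : State) {d : ℕ} : ((initLabel d).eval q).arr 3 = q.arr 3 := by
      ext j
      exact (initLabel_spec q d).2 3 j (by omega)
    obtain ⟨p0, q0⟩ := initLabel_spec r 0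
    obtain ⟨p1, q1⟩ := initLabel_spec ((initLabel 0).eval r) 1
    obtain ⟨p2, q2⟩ := initLabel_spec ((initLabel 1).eval ((initLabel 0).eval r)) 2
    simp only [e, e1, e3, v5, v6, a1, a3, h10] at p0 q0 p1 q1 p2 q2
    simp only [eval_seq, State.setVar_arr]
    generalize (initLabel 2).eval ((initLabel 1).eval ((initLabel 0).eval r)) = r₃ at p2 q2 ⊢
    generalize (initLabel 1).eval ((initLabel 0).eval r) = r₂ at p1 q1 q2 ⊢
    generalize (initLabel 0).eval r = r₁ at p0 q0 q1 ⊢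
    rcases Nat.lt_succ_iff_lt_or_eq.1 hw with hw | rfl
    · rw [q2 _ _ (by omega), q1 _ _ (by omega), q0 _ _ (by omega)]
      exact hI w hw c hc
    · interval_cases c
      · rwa [q2 _ _ (by omega), q1 _ _ (by omega)]
      · rwa [q2 _ _ (by omega)]
      · exact p2

end Separation

/-! ### Search with prescribed labels on the dominating set -/

namespace Separation

open Finset RAM RAM.LoopProgram

/-- Copy the characteristic vector of the vertices with label `1` to array `2`, and set register `2`
to `1`. -/
def output : LoopProgram :=
  seq (forLoop 10 (cond (.eq (.get 11 (.var 10)) (.const 0)) (store 2 (.var 10) (.const 0))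
    (store 2 (.var 10) (.const 1)))) (assign 2 (.const 1))

theorem output_spec (s : State) : (output.eval s).var 2 = 1 ∧
    ∀ v < s.var 0, (output.eval s).arr 2 v =
      if (1, v) ∈ lists (s.var 0) 10 s then 1 else 0 := by
  have := eval_forLoop_induction (x := 10)
    (P := cond (.eq (.get 11 (.var 10)) (.const 0)) (store 2 (.var 10) (.const 0))
      (store 2 (.var 10) (.const 1))) s rfl
    (fun i r => ∀ w < i, r.arr 2 w = if s.arr 11 w = 0 then 0 else 1)
    (fun w hw => absurd hw (Nat.not_lt_zero w)) ?_
  · refine ⟨by simp [output, eval_seq, eval_assign, State.setVar_var, Expr.value], fun v hv => ?_⟩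
    rw [output, eval_seq, eval_assign, State.setVar_arr, this v hv]
    by_cases h : s.arr 11 v = 0 <;> simp [mem_lists, hv, h]
  · intro i r hi h10 hvar harr hI w hw
    have e0 : r.arr 11 = s.arr 11 := harr 11 rfl
    simp only [eval_store, eval_cond_eq, select_eq_ite, Expr.value, State.setVar_arr, h10, e0]
    rcases Nat.lt_succ_iff_lt_or_eq.1 hw with hw | rfl
    · have := hw.ne
      rw [← hI w hw]
      split_ifs <;> simp [State.setArr_arr, this]
    · split_ifs <;> simp [State.setArr_arr]

/-- `o` is the characteristic vector of the label `1` in a labelling in which the labels `0` and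
`2` occur. -/
def IsSolution (n : ℕ) (A : ℕ → ℕ → Prop) (o : ℕ → ℕ) : Prop :=
  ∃ g a b, IsLabelling n A g ∧ a < n ∧ b < n ∧ g a = 0 ∧ g b = 2 ∧
    ∀ v < n, o v = if g v = 1 then 1 else 0

/-- Search for a labelling with the labels in array `3` for the vertices in array `1`, label `0` for
vertex `var 5` and label `2` for vertex `var 6`. -/
def tryPair : LoopProgram :=
  seq init (seq decideAll (seq thin (seq propagate (seq checkFull
    (cond (.eq (.var 12) (.const 1)) output skip)))))

/-- Some labelling agrees with `col` on the vertices in `X` and gives `0` to `a` and `2` to `b`. -/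
def IsExtendable (n : ℕ) (A : ℕ → ℕ → Prop) (X col : ℕ → ℕ) (a b : ℕ) : Prop :=
  ∃ f, IsLabelling n A f ∧ f a = 0 ∧ f b = 2 ∧ ∀ v < n, X v = 1 → col v = f v

/-- Either the memory `r` reports a solution, or it agrees with `s` in what is reported and `P`
holds. -/
def IsReport (n : ℕ) (A : ℕ → ℕ → Prop) (P : Prop) (s r : State) : Prop :=
  (r.var 2 = 1 ∧ IsSolution n A (r.arr 2)) ∨ (r.var 2 = s.var 2 ∧ r.arr 2 = s.arr 2 ∧ P)

/-- A reported solution may be replaced by a later one but never gets lost. -/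
theorem IsReport.trans {n : ℕ} {A : ℕ → ℕ → Prop} {P P' : Prop} {s r q : State}
    (h : IsReport n A P s r) (h' : IsReport n A P' r q) : IsReport n A (P ∧ P') s q := by
  rcases h' with h' | ⟨h1, h2, h3⟩
  · exact .inl h'
  · rcases h with ⟨h4, h5⟩ | ⟨h4, h5, h6⟩
    · exact .inl ⟨h1.trans h4, h2 ▸ h5⟩
    · exact .inr ⟨h1.trans h4, h2.trans h5, h6, h3⟩

theorem IsReport.mono {n : ℕ} {A : ℕ → ℕ → Prop} {P P' : Prop} {s r : State}
    (h : IsReport n A P s r) (hP : P → P') : IsReport n A P' s r :=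
  h.imp_right fun h => ⟨h.1, h.2.1, hP h.2.2⟩

/-- The input is a symmetric graph with a dominating set. -/
def IsValidInput (n : ℕ) (M X : ℕ → ℕ) : Prop :=
  (∀ u < n, ∀ v < n, rowAdj n M u v → rowAdj n M v u) ∧
    ∀ v < n, X v = 1 ∨ ∃ x < n, X x = 1 ∧ rowAdj n M v x

/-- If the check succeeds, the thinned and propagated lists are themselves a labelling inside the
initial lists. If it fails, an extension `f` would have led to singleton lists forming a labelling,
which thinning and propagation preserve. -/
theorem tryPair_spec (s : State) (ha : s.var 5 < s.var 0) (hb : s.var 6 < s.var 0)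
    (hin : IsValidInput (s.var 0) (s.arr 0) (s.arr 1)) :
    IsReport (s.var 0) (rowAdj (s.var 0) (s.arr 0))
      (¬ IsExtendable (s.var 0) (rowAdj (s.var 0) (s.arr 0)) (s.arr 1) (s.arr 3) (s.var 5)
        (s.var 6)) s (tryPair.eval s) := by
  have e1v (y : ℕ) (h : init.writesVar y = false) := eval_var_of_not_writesVar init h s
  have e1a (y : ℕ) (h : init.writesArr y = false) := eval_arr_of_not_writesArr init h s
  have i1 := init_spec s
  rw [tryPair, eval_seq, eval_seq, eval_seq, eval_seq, eval_seq]
  generalize init.eval s = s₁ at e1v e1a i1 ⊢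
  have e2v (y : ℕ) (h : decideAll.writesVar y = false) := eval_var_of_not_writesVar _ h s₁
  have e2a (y : ℕ) (h : decideAll.writesArr y = false) := eval_arr_of_not_writesArr _ h s₁
  have i2 := decideAll_spec s₁
  generalize decideAll.eval s₁ = s₂ at e2v e2a i2 ⊢
  have e3v (y : ℕ) (h : thin.writesVar y = false) := eval_var_of_not_writesVar _ h s₂
  have e3a (y : ℕ) (h : thin.writesArr y = false) := eval_arr_of_not_writesArr _ h s₂
  have i3 := thin_spec s₂
  generalize thin.eval s₂ = s₃ at e3v e3a i3 ⊢
  have e4v (y : ℕ) (h : propagate.writesVar y = false) := eval_var_of_not_writesVar _ h s₃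
  have e4a (y : ℕ) (h : propagate.writesArr y = false) := eval_arr_of_not_writesArr _ h s₃
  have i4 := propagate_spec s₃
  generalize propagate.eval s₃ = s₄ at e4v e4a i4 ⊢
  have e5v (y : ℕ) (h : checkFull.writesVar y = false) := eval_var_of_not_writesVar _ h s₄
  have e5a (y : ℕ) (h : checkFull.writesArr y = false) := eval_arr_of_not_writesArr _ h s₄
  have i5 := checkFull_spec s₄
  generalize checkFull.eval s₄ = s₅ at e5v e5a i5 ⊢
  have t5 : lists (s.var 0) 10 s₅ = lists (s.var 0) 10 s₄ :=
    lists_congr fun c _ => e5a (10 + c) rfl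
  have n1 : s₁.var 0 = s.var 0 := e1v 0 rfl
  have n2 : s₂.var 0 = s.var 0 := (e2v 0 rfl).trans n1
  have n3 : s₃.var 0 = s.var 0 := (e3v 0 rfl).trans n2
  have n4 : s₄.var 0 = s.var 0 := (e4v 0 rfl).trans n3
  have n5 : s₅.var 0 = s.var 0 := (e5v 0 rfl).trans n4
  have m1 : s₁.arr 0 = s.arr 0 := e1a 0 rfl
  have m3 : s₃.arr 0 = s.arr 0 := (e3a 0 rfl).trans ((e2a 0 rfl).trans m1)
  have f5 : s₅.var 2 = s.var 2 := (e5v 2 rfl).trans ((e4v 2 rfl).trans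
    ((e3v 2 rfl).trans ((e2v 2 rfl).trans (e1v 2 rfl))))
  have o5 : s₅.arr 2 = s.arr 2 := (e5a 2 rfl).trans ((e4a 2 rfl).trans
    ((e3a 2 rfl).trans ((e2a 2 rfl).trans (e1a 2 rfl))))
  have i6 := output_spec s₅
  rw [eval_cond_eq, Expr.value, Expr.value, select_eq_ite]
  clear e1v e1a e2v e2a e3v e3a e4v e4a e5v e5a
  rw [n1, m1] at i2
  rw [n2] at i3
  rw [n3, m3] at i4
  rw [n4] at i5
  rw [n5, t5] at i6
  rcases i5 with ⟨hok, hfull⟩ | ⟨hok, hfull⟩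
  · left
    rw [if_pos hok]
    refine ⟨i6.1, ?_⟩
    have hsub (c v : ℕ) (h : (c, v) ∈ lists (s.var 0) 10 s₄) :=
      (i3 c v).1 (i4.1 h)
    have hall (c v : ℕ) (h : (c, v) ∈ lists (s.var 0) 10 s₄) :=
      ((i1 c v).1 (i2.1 (hsub c v h).1)).2.2
    obtain ⟨g, hg, hgT⟩ := i4.2.1.exists_isLabelling_of_functional hfull (lists_subset_box _ _ _) (by
      intro c d v hc hd
      rcases lt_trichotomy c d with h | h | h
      · exact absurd (hsub c v hc).1 ((hsub d v hd).2 c h)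
      · exact h
      · exact absurd (hsub d v hd).1 ((hsub c v hc).2 d h))
    refine ⟨g, s.var 5, s.var 6, hg, ha, hb, ?_, ?_, fun v hv => ?_⟩
    · exact (hall _ _ ((hgT _ ha _).2 rfl)).2.1 rfl
    · exact (hall _ _ ((hgT _ hb _).2 rfl)).2.2 rfl
    · rw [i6.2 v hv]
      simp only [hgT v hv]
  · right
    rw [if_neg (by rw [hok]; omega)]
    refine ⟨f5, o5, ?_⟩
    rintro ⟨f, hf, hfa, hfb, hfX⟩
    -- The dominating set is cut down to numbers below `n`, which supplies the bound that `hfX` asks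
    -- for.
    have hdec := i2.2 f (fun x => x < s.var 0 ∧ s.arr 1 x = 1) hin.1 hf
      (fun v hv => (hin.2 v hv).imp (fun h => ⟨hv, h⟩)
        fun ⟨x, hx, hX, hA⟩ => ⟨x, hx, ⟨hx, hX⟩, hA⟩)
      (fun c x hx h => (((i1 c x).1 h).2.2.1 hx.2).symm.trans (hfX x hx.1 hx.2))
      (graphOn_subset_iff.2 fun v hv => (i1 _ _).2
        ⟨hf.1 v hv, hv, fun h => hfX v hv h, fun h => h ▸ hfa, fun h => h ▸ hfb⟩)
    obtain ⟨⟨g, hg, hgL⟩, huniq⟩ := hdec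
    refine hfull ((isFull_graphOn _ g).mono (i4.graphOn_subset hg ?_))
    rw [graphOn_subset_iff] at hgL ⊢
    refine fun v hv => (i3 _ _).2 ⟨hgL v hv, fun d hd hm => ?_⟩
    have hv3 := hg.1 v hv
    -- A smaller label `d` left at `v` would be forced on `g` as well.
    exact hd.ne' (huniq d v ⟨hv, by omega⟩ hm g hg (graphOn_subset_iff.2 hgL))

/-- Search for a labelling with the labels in array `3` for the vertices in array `1`. -/
def searchPairs : LoopProgram := forLoop 5 (forLoop 6 tryPair)

theorem searchPairs_spec (s : State) (hin : IsValidInput (s.var 0) (s.arr 0) (s.arr 1)) :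
    IsReport (s.var 0) (rowAdj (s.var 0) (s.arr 0))
      (∀ a < s.var 0, ∀ b < s.var 0,
        ¬ IsExtendable (s.var 0) (rowAdj (s.var 0) (s.arr 0)) (s.arr 1) (s.arr 3) a b)
      s (searchPairs.eval s) := by
  refine eval_forLoop_induction (x := 5) (P := forLoop 6 tryPair) s rfl
    (fun i r => IsReport (s.var 0) (rowAdj (s.var 0) (s.arr 0))
      (∀ a < i, ∀ b < s.var 0,
        ¬ IsExtendable (s.var 0) (rowAdj (s.var 0) (s.arr 0)) (s.arr 1) (s.arr 3) a b) s r)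
    (.inr ⟨rfl, rfl, fun a ha => absurd ha (Nat.not_lt_zero a)⟩) ?_
  intro i r hi h5 hvar harr hI
  have r0 : r.var 0 = s.var 0 := hvar 0 rfl
  have rM : r.arr 0 = s.arr 0 := harr 0 rfl
  have rX : r.arr 1 = s.arr 1 := harr 1 rfl
  have r3 : r.arr 3 = s.arr 3 := harr 3 rfl
  have hrow : IsReport (s.var 0) (rowAdj (s.var 0) (s.arr 0))
      (∀ b < r.var 0, ¬ IsExtendable (s.var 0) (rowAdj (s.var 0) (s.arr 0)) (s.arr 1) (s.arr 3) i b)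
      r ((forLoop 6 tryPair).eval r) := by
    refine eval_forLoop_induction (x := 6) (P := tryPair) r rfl
      (fun j q => IsReport (s.var 0) (rowAdj (s.var 0) (s.arr 0))
        (∀ b < j, ¬ IsExtendable (s.var 0) (rowAdj (s.var 0) (s.arr 0)) (s.arr 1) (s.arr 3) i b)
        r q)
      (.inr ⟨rfl, rfl, fun a ha => absurd ha (Nat.not_lt_zero a)⟩) ?_
    intro j q hj h6 hvar' harr' hJ
    have q0 : q.var 0 = s.var 0 := (hvar' 0 rfl).trans r0
    have q5 : q.var 5 = i := (hvar' 5 rfl).trans h5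
    have qM : q.arr 0 = s.arr 0 := (harr' 0 rfl).trans rM
    have qX : q.arr 1 = s.arr 1 := (harr' 1 rfl).trans rX
    have q3 : q.arr 3 = s.arr 3 := (harr' 3 rfl).trans r3
    have ht := tryPair_spec q (by omega) (by omega) (by rwa [q0, qM, qX])
    rw [q0, qM, qX, q3, q5, h6] at ht
    refine (hJ.trans ht).mono ?_
    rintro ⟨h1, h2⟩ b hb
    rcases Nat.lt_succ_iff_lt_or_eq.1 hb with hb | rfl
    · exact h1 b hb
    · exact h2
  rw [r0] at hrow
  refine (hI.trans hrow).mono ?_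
  rintro ⟨h1, h2⟩ a ha
  rcases Nat.lt_succ_iff_lt_or_eq.1 ha with ha | rfl
  · exact h1 a ha
  · exact h2

end Separation

namespace Separation

open Finset RAM RAM.LoopProgram

/-! ### The ternary counter -/

/-- The number with the ternary digits `col v` for `v < n` in `X`. -/
def rank (X col : ℕ → ℕ) (n : ℕ) : ℕ :=
  ∑ v ∈ range n, if X v = 1 then col v * 3 ^ Nat.count (fun u => X u = 1) v else 0

theorem rank_succ (X col : ℕ → ℕ) (n : ℕ) : rank X col (n + 1) =
    rank X col n + if X n = 1 then col n * 3 ^ Nat.count (fun u => X u = 1) n else 0 :=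
  sum_range_succ _ _

/-- The place of a digit is the number of elements of `X` before it, so the digits fill consecutive
places and the bound depends on the size of `X` only. -/
theorem rank_lt {X col : ℕ → ℕ} {n : ℕ} (h : ∀ v < n, X v = 1 → col v < 3) :
    rank X col n < 3 ^ Nat.count (fun u => X u = 1) n := by
  induction n with
  | zero => simp [rank]
  | succ n ih =>
    have ih := ih fun v hv => h v (by omega)
    rw [rank_succ, Nat.count_succ]
    split_ifs with hX
    · have hc := h n (by omega) hX
      have := Nat.mul_le_mul_right (3 ^ Nat.count (fun u => X u = 1) n) (show col n ≤ 2 by omega)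
      rw [pow_succ]
      omega
    · simpa using ih

/-- Remainder and quotient by the power of 3 at the last place separate the last digit from the
others. -/
theorem eq_of_rank_eq {X c d : ℕ → ℕ} {n : ℕ} (hc : ∀ v < n, X v = 1 → c v < 3)
    (hd : ∀ v < n, X v = 1 → d v < 3) (h : rank X c n = rank X d n) :
    ∀ v < n, X v = 1 → c v = d v := by
  induction n with
  | zero => exact fun v hv => absurd hv (Nat.not_lt_zero v)
  | succ n ih =>
    have hc' : ∀ v < n, X v = 1 → c v < 3 := fun v hv => hc v (by omega)
    have hd' : ∀ v < n, X v = 1 → d v < 3 := fun v hv => hd v (by omega)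
    have h1 := rank_lt hc'
    have h2 := rank_lt hd'
    rw [rank_succ, rank_succ] at h
    intro v hv hX
    by_cases hn : X n = 1
    · rw [if_pos hn, if_pos hn] at h
      have e1 := congrArg (· % 3 ^ Nat.count (fun u => X u = 1) n) h
      have e2 := congrArg (· / 3 ^ Nat.count (fun u => X u = 1) n) h
      simp only [Nat.add_mul_mod_self_right, Nat.mod_eq_of_lt h1, Nat.mod_eq_of_lt h2] at e1
      simp only [Nat.add_mul_div_right _ _ (show 0 < 3 ^ Nat.count (fun u => X u = 1) n by positivity),
        Nat.div_eq_of_lt h1, Nat.div_eq_of_lt h2, zero_add] at e2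
      rcases Nat.lt_succ_iff_lt_or_eq.1 hv with hv | rfl
      · exact ih hc' hd' e1 v hv hX
      · exact e2
    · rw [if_neg hn, if_neg hn] at h
      rcases Nat.lt_succ_iff_lt_or_eq.1 hv with hv | rfl
      · exact ih hc' hd' h v hv hX
      · exact absurd hX hn

theorem rank_congr {X c d : ℕ → ℕ} {n : ℕ} (h : ∀ v < n, c v = d v) : rank X c n = rank X d n :=
  sum_congr rfl fun v hv => by rw [h v (mem_range.1 hv)]

/-- Increase the digits in array `3` of the vertices in array `1`, and set register `3` to `1` if
there was an overflow and to `0` otherwise. -/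
def increment : LoopProgram :=
  seq (assign 3 (.const 1)) (forLoop 4
    (cond (.eq (.get 1 (.var 4)) (.const 1)) (cond (.eq (.var 3) (.const 1))
      (cond (.eq (.get 3 (.var 4)) (.const 2)) (store 3 (.var 4) (.const 0))
        (seq (store 3 (.var 4) (.succ (.get 3 (.var 4)))) (assign 3 (.const 0)))) skip) skip))

/-- Register 3 is the carry, and its initial value 1 is the summand. After `i` digits, the new lower
part plus the carry at the next place exceeds the old lower part by 1; digits from `i` on are still
untouched. -/
theorem increment_spec (s : State) (hs : ∀ v < s.var 0, s.arr 1 v = 1 → s.arr 3 v < 3) :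
    (∀ v < s.var 0, s.arr 1 v = 1 → (increment.eval s).arr 3 v < 3) ∧
    ((increment.eval s).var 3 = 0 ∨ (increment.eval s).var 3 = 1) ∧
    rank (s.arr 1) ((increment.eval s).arr 3) (s.var 0) +
      (increment.eval s).var 3 * 3 ^ Nat.count (fun u => s.arr 1 u = 1) (s.var 0) =
      rank (s.arr 1) (s.arr 3) (s.var 0) + 1 := by
  have := eval_forLoop_induction (x := 4)
    (P := cond (.eq (.get 1 (.var 4)) (.const 1)) (cond (.eq (.var 3) (.const 1))
      (cond (.eq (.get 3 (.var 4)) (.const 2)) (store 3 (.var 4) (.const 0))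
        (seq (store 3 (.var 4) (.succ (.get 3 (.var 4)))) (assign 3 (.const 0)))) skip) skip)
    (s.setVar 3 1) rfl
    (fun i r => (∀ v < s.var 0, s.arr 1 v = 1 → r.arr 3 v < 3) ∧
      (∀ v, i ≤ v → r.arr 3 v = s.arr 3 v) ∧ (r.var 3 = 0 ∨ r.var 3 = 1) ∧
      rank (s.arr 1) (r.arr 3) i + r.var 3 * 3 ^ Nat.count (fun u => s.arr 1 u = 1) i =
        rank (s.arr 1) (s.arr 3) i + 1)
    ⟨hs, fun v _ => rfl, .inr (by simp [State.setVar_var]), by simp [rank, State.setVar_var]⟩ ?_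
  · exact ⟨this.1, this.2.2⟩
  · intro i r hi h4 hvar harr ⟨hI, hge, hcarry, hrank⟩
    have hi : i < s.var 0 := hi
    have r1 : r.arr 1 = s.arr 1 := harr 1 rfl
    have hri := hge i le_rfl
    simp only [eval_seq, eval_store, eval_assign, eval_skip, eval_cond_eq, Expr.value,
      select_eq_ite, h4, r1, hri]
    rw [rank_succ, rank_succ, Nat.count_succ]
    by_cases hX : s.arr 1 i = 1
    · rcases hcarry with hc | hc
      · simp only [hX, hc, if_true, zero_ne_one, if_false, State.setVar_arr, State.setVar_var,
          hri] at hrank ⊢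
        refine ⟨hI, fun v hv => hge v (by omega), by simp, ?_⟩
        simp
        omega
      · by_cases h2 : s.arr 3 i = 2
        · simp only [hX, hc, h2, if_true, State.setVar_arr, State.setVar_var] at hrank ⊢
          have hr : rank (s.arr 1) ((r.setArr 3 i 0).arr 3) i = rank (s.arr 1) (r.arr 3) i :=
            rank_congr fun v hv => by rw [State.setArr_arr, if_neg (by omega)]
          refine ⟨fun v hv hvX => ?_, fun v hv => ?_, by simp [hc], ?_⟩
          · rw [State.setArr_arr]
            split_ifs
            · omega
            · exact hI v hv hvX
          · rw [State.setArr_arr, if_neg (by omega), hge v (by omega)]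
          · rw [hr]
            simp [State.setArr_arr, hc, pow_succ]
            omega
        · have h3 := hs i hi hX
          simp only [hX, hc, h2, if_true, if_false, State.setVar_arr, State.setVar_var] at hrank ⊢
          have hr : rank (s.arr 1) ((r.setArr 3 i (s.arr 3 i + 1)).arr 3) i =
              rank (s.arr 1) (r.arr 3) i :=
            rank_congr fun v hv => by rw [State.setArr_arr, if_neg (by omega)]
          refine ⟨fun v hv hvX => ?_, fun v hv => ?_, by simp, ?_⟩
          · rw [State.setArr_arr]
            split_ifs
            · omega
            · exact hI v hv hvX
          · rw [State.setArr_arr, if_neg (by omega), hge v (by omega)]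
          · rw [hr]
            simp [State.setArr_arr, add_mul]
            omega
    · simp only [hX, if_false, State.setVar_arr, State.setVar_var, add_zero]
      exact ⟨hI, fun v hv => hge v (by omega), by simpa using hcarry, by simpa using hrank⟩

/-! ### The complete algorithm -/

/-- The body of the main loop. -/
def searchStep : LoopProgram := seq searchPairs increment

/-- The algorithm. -/
def algorithm : Program :=
  .seq (.loop (.eq (.var 3) (.const 0)) searchStep.toProgram) (.assign 0 (.var 2))

/-- What is known when the main loop has dealt with all labellings of rank below `m`. -/
def IsSearched (n : ℕ) (A : ℕ → ℕ → Prop) (X : ℕ → ℕ) (m : ℕ) (s : State) : Prop :=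
  (s.var 2 = 1 ∧ IsSolution n A (s.arr 2)) ∨
    (s.var 2 = 0 ∧ ∀ f, IsLabelling n A f → ∀ a < n, ∀ b < n, f a = 0 → f b = 2 → m ≤ rank X f n)

/-- A labelling whose rank is that of the current digits agrees with them on `X`, so it would extend
them for some pair. If the search fails, the ranks of all labellings sought are therefore larger. -/
theorem searchStep_spec (s : State) (hin : IsValidInput (s.var 0) (s.arr 0) (s.arr 1))
    (hs : ∀ v < s.var 0, s.arr 1 v = 1 → s.arr 3 v < 3)
    (hI : IsSearched (s.var 0) (rowAdj (s.var 0) (s.arr 0)) (s.arr 1)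
      (rank (s.arr 1) (s.arr 3) (s.var 0)) s) :
    IsSearched (s.var 0) (rowAdj (s.var 0) (s.arr 0)) (s.arr 1)
      (rank (s.arr 1) (s.arr 3) (s.var 0) + 1) (searchStep.eval s) ∧
    (∀ v < s.var 0, s.arr 1 v = 1 → (searchStep.eval s).arr 3 v < 3) ∧
    ((searchStep.eval s).var 3 = 0 ∨ (searchStep.eval s).var 3 = 1) ∧
    rank (s.arr 1) ((searchStep.eval s).arr 3) (s.var 0) +
      (searchStep.eval s).var 3 * 3 ^ Nat.count (fun u => s.arr 1 u = 1) (s.var 0) =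
      rank (s.arr 1) (s.arr 3) (s.var 0) + 1 := by
  have e1 : (searchPairs.eval s).arr 1 = s.arr 1 := eval_arr_of_not_writesArr _ rfl _
  have e3 : (searchPairs.eval s).arr 3 = s.arr 3 := eval_arr_of_not_writesArr _ rfl _
  have e0 : (searchPairs.eval s).var 0 = s.var 0 := eval_var_of_not_writesVar _ rfl _
  have hp := searchPairs_spec s hin
  rw [searchStep, eval_seq]
  generalize searchPairs.eval s = r at e1 e3 e0 hp ⊢
  have hi := increment_spec r (by rwa [e1, e3, e0])
  rw [e1, e3, e0] at hi
  have f2 : (increment.eval r).var 2 = r.var 2 := eval_var_of_not_writesVar _ rfl _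
  have o2 : (increment.eval r).arr 2 = r.arr 2 := eval_arr_of_not_writesArr _ rfl _
  refine ⟨?_, hi⟩
  rw [IsSearched, f2, o2]
  rcases hp with hp | ⟨h1, h2, h3⟩
  · exact .inl hp
  · rw [h1, h2]
    refine hI.imp_right fun h => ⟨h.1, fun f hf a ha b hb hfa hfb => ?_⟩
    refine Nat.lt_of_le_of_ne (h.2 f hf a ha b hb hfa hfb) fun he => ?_
    exact h3 a ha b hb ⟨f, hf, hfa, hfb,
      eq_of_rank_eq hs (fun v hv _ => hf.1 v hv) he⟩

/-- Here `m` counts the digit vectors not yet treated, the current one included; it is positive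
because a rank is less than `3 ^ k`. Without overflow the rank has grown by 1, and an overflow means
that the current vector was the last. -/
theorem exists_run_loop (n : ℕ) (M X : ℕ → ℕ) (hin : IsValidInput n M X) (m : ℕ) (s : State)
    (h0 : s.var 0 = n) (hM : s.arr 0 = M) (hX : s.arr 1 = X) (h3 : s.var 3 = 0)
    (hs : ∀ v < n, X v = 1 → s.arr 3 v < 3)
    (hI : IsSearched n (rowAdj n M) X (rank X (s.arr 3) n) s)
    (hm : rank X (s.arr 3) n + m = 3 ^ Nat.count (fun u => X u = 1) n) :
    ∃ t r, Run (.loop (.eq (.var 3) (.const 0)) searchStep.toProgram) s t r ∧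
      t ≤ m * (searchStep.cost.eval n + 3) + 3 ∧
      IsSearched n (rowAdj n M) X (3 ^ Nat.count (fun u => X u = 1) n) r := by
  induction m generalizing s with
  | zero =>
    have := rank_lt hs
    omega
  | succ m ih =>
    obtain ⟨t, ht, hrun⟩ := exists_run searchStep rfl s
    have e0 : (searchStep.eval s).var 0 = s.var 0 := eval_var_of_not_writesVar _ rfl _
    have eM : (searchStep.eval s).arr 0 = s.arr 0 := eval_arr_of_not_writesArr _ rfl _
    have eX : (searchStep.eval s).arr 1 = s.arr 1 := eval_arr_of_not_writesArr _ rfl _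
    obtain ⟨g1, g2, g3, g4⟩ := searchStep_spec s (by rwa [h0, hM, hX]) (by rwa [h0, hX])
      (by rwa [h0, hM, hX])
    rw [h0] at e0 ht
    rw [hM] at eM
    rw [hX] at eX
    rw [h0, hM, hX] at g1
    rw [h0, hX] at g2 g4
    generalize searchStep.eval s = r at *
    have hlt := rank_lt g2
    have hb : (Test.eq (.var 3) (.const 0)).Holds s := h3
    rcases g3 with g3 | g3
    · rw [g3, zero_mul, add_zero] at g4
      obtain ⟨t', q, hr, ht', hq⟩ := ih r e0 eM eX g3 g2 (g4 ▸ g1) (by omega)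
      refine ⟨_, q, Run.loop_true hb hrun hr, ?_, hq⟩
      simp only [Test.cost, Expr.cost]
      rw [add_mul, one_mul]
      omega
    · rw [g3, one_mul] at g4
      refine ⟨_, r, Run.loop_true hb hrun (Run.loop_false ?_), ?_, ?_⟩
      · simp [Test.Holds, Expr.value, g3]
      · simp only [Test.cost, Expr.cost]
        rw [add_mul, one_mul]
        omega
      · have : 3 ^ Nat.count (fun u => X u = 1) n = rank X (s.arr 3) n + 1 := by omega
        rwa [this]

/-! ### Graphs -/

/-- Division by `n` with remainder recovers `u` and `v` from the address, so distinct entries do not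
share a cell. -/
theorem rowAdj_inputState {n : ℕ} (G : SimpleGraph (Fin n)) (X : Finset (Fin n)) (u v : Fin n) :
    rowAdj n ((inputState G X).arr 0) u v ↔ G.Adj u v := by
  simp only [rowAdj, inputState, if_true]
  have hn : 0 < n := u.pos
  constructor
  · intro h
    by_contra hne
    rw [if_neg] at h
    · omega
    rintro ⟨u', v', hadj, he⟩
    have e1 := congrArg (· % n) he
    have e2 := congrArg (· / n) he
    simp only [Nat.mul_add_mod_self_right, Nat.mod_eq_of_lt v.2, Nat.mod_eq_of_lt v'.2] at e1
    simp only [mul_comm _ n, Nat.mul_add_div hn, Nat.div_eq_of_lt v.2, Nat.div_eq_of_lt v'.2,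
      add_zero] at e2
    rw [Fin.ext e1, Fin.ext e2] at hne
    exact hne hadj
  · intro h
    rw [if_pos ⟨u, v, h, rfl⟩]

theorem mem_inputState {n : ℕ} (G : SimpleGraph (Fin n)) (X : Finset (Fin n)) (v : Fin n) :
    (inputState G X).arr 1 v = 1 ↔ v ∈ X := by
  simp [inputState, ← Fin.ext_iff]

theorem count_inputState {n : ℕ} (G : SimpleGraph (Fin n)) (X : Finset (Fin n)) :
    Nat.count (fun u => (inputState G X).arr 1 u = 1) n = X.card := by
  rw [Nat.count_eq_card_filter_range, ← card_map Fin.valEmbedding]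
  congr 1
  ext u
  simp only [mem_filter, mem_range, mem_map, Fin.valEmbedding_apply]
  constructor
  · rintro ⟨hu, h⟩
    exact ⟨⟨u, hu⟩, (mem_inputState G X ⟨u, hu⟩).1 h, rfl⟩
  · rintro ⟨v, hv, rfl⟩
    exact ⟨v.2, (mem_inputState G X v).2 hv⟩

theorem isValidInput_inputState {n : ℕ} (G : SimpleGraph (Fin n)) (X : Finset (Fin n))
    (hX : G.IsDominatingSet (X : Set (Fin n))) :
    IsValidInput n ((inputState G X).arr 0) ((inputState G X).arr 1) := by
  refine ⟨fun u hu v hv h => ?_, fun v hv => ?_⟩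
  · exact (rowAdj_inputState G X ⟨v, hv⟩ ⟨u, hu⟩).2
      ((rowAdj_inputState G X ⟨u, hu⟩ ⟨v, hv⟩).1 h).symm
  · refine (hX ⟨v, hv⟩).imp (fun h => (mem_inputState G X ⟨v, hv⟩).2 h) ?_
    rintro ⟨x, hx, h⟩
    exact ⟨x, x.2, (mem_inputState G X x).2 hx, (rowAdj_inputState G X ⟨v, hv⟩ x).2 h⟩

variable {n : ℕ} {G : SimpleGraph (Fin n)} {A : ℕ → ℕ → Prop}

theorem IsLabelling.isIndependentCutset (hA : ∀ u v : Fin n, A u v ↔ G.Adj u v) {g : ℕ → ℕ}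
    (hg : IsLabelling n A g) {a b : Fin n} (ha : g a = 0) (hb : g b = 2) :
    G.IsIndependentCutset {v : Fin n | g v = 1} := by
  refine ⟨fun hpre => ?_, fun u hu v hv _ hadj => ?_⟩
  · have hreach := hpre ⟨a, by simp [ha]⟩ ⟨b, by simp [hb]⟩
    -- Without vertices of label 1, a walk cannot leave label 0, since no edge joins 0 to 2; so it
    -- never reaches `b`.
    have key (u v : ({v : Fin n | g v = 1}ᶜ : Set (Fin n)))
        (w : (G.induce ({v : Fin n | g v = 1}ᶜ : Set (Fin n))).Walk u v) :
        g u.1 = 0 → g v.1 = 0 := by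
      induction w with
      | nil => exact id
      | @cons u v w h p ih =>
        intro hu
        refine ih ?_
        have h1 := hg.2 u.1 u.1.2 v.1 v.1.2 ((hA _ _).2 (SimpleGraph.comap_adj.1 h))
        have h2 := hg.1 v.1 v.1.2
        have h3 : ¬ g v.1 = 1 := v.2
        omega
    obtain ⟨w⟩ := hreach
    have := key _ _ w ha
    simp only [hb] at this
    omega
  · have hu : g u = 1 := hu
    have hv : g v = 1 := hv
    exact hg.2 u u.2 v v.2 ((hA u v).2 hadj) (by omega)

theorem exists_isLabelling_of_isIndependentCutset (hA : ∀ u v : Fin n, A u v ↔ G.Adj u v)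
    {S : Set (Fin n)} (hS : G.IsIndependentCutset S) :
    ∃ g, IsLabelling n A g ∧ ∃ a b : Fin n, g a = 0 ∧ g b = 2 := by
  classical
  obtain ⟨hcut, hind⟩ := hS
  simp only [SimpleGraph.IsCutset, SimpleGraph.Preconnected, not_forall] at hcut
  obtain ⟨a, b, hab⟩ := hcut
  -- `R` is the component of `a` in `G - S`. It gets label 0, `S` gets 1 and everything else 2; an
  -- edge from label 0 to label 2 would enlarge the component.
  set R : Fin n → Prop := fun v => ∃ h : v ∈ Sᶜ, (G.induce Sᶜ).Reachable a ⟨v, h⟩ with hR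
  have hRadj (u v : Fin n) (h : G.Adj u v) (hu : R u) (hv : v ∉ S) : R v := by
    obtain ⟨hu', hr⟩ := hu
    exact ⟨hv, hr.trans (SimpleGraph.Adj.reachable (by simpa using h))⟩
  have hRS (u : Fin n) (h : R u) : u ∉ S := h.1
  set g : ℕ → ℕ := fun v => if h : v < n then
    if (⟨v, h⟩ : Fin n) ∈ S then 1 else if R ⟨v, h⟩ then 0 else 2 else 0 with hg
  have hgv (v : Fin n) : g v = if v ∈ S then 1 else if R v then 0 else 2 := by
    simp [hg]
  refine ⟨g, ⟨fun v hv => ?_, fun u hu v hv huv => ?_⟩, a.1, b.1, ?_, ?_⟩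
  · rw [hgv ⟨v, hv⟩]
    split_ifs <;> omega
  · have hadj := (hA ⟨u, hu⟩ ⟨v, hv⟩).1 huv
    rw [hgv ⟨u, hu⟩, hgv ⟨v, hv⟩]
    have k1 := hRadj _ _ hadj
    have k2 := hRadj _ _ hadj.symm
    have k3 : ¬ (⟨u, hu⟩ ∈ S ∧ ⟨v, hv⟩ ∈ S) := fun h => hind h.1 h.2 hadj.ne hadj
    split_ifs <;> first | omega | tauto
  · rw [hgv, if_neg a.2, if_pos ⟨a.2, SimpleGraph.Reachable.refl _⟩]
  · rw [hgv, if_neg b.2, if_neg]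
    rintro ⟨_, h⟩
    exact hab h

end Separation

open Separation in
theorem mainTheorem1 :
    ∃ (P : RAM.Program) (p : Polynomial ℕ),
      ∀ (n : ℕ) (G : SimpleGraph (Fin n)) (X : Finset (Fin n)),
        G.Connected → G.IsDominatingSet (X : Set (Fin n)) →
          ∃ (t : ℕ) (s : RAM.State),
            RAM.Run P (inputState G X) t s ∧
              t ≤ 3 ^ X.card * p.eval n ∧ IsCorrectAnswer G s := by
  -- Each round adds 3 for its test, the last test costs 3 and the final assignment 2. These last 5
  -- steps are absorbed into the factor `3 ^ k ≥ 1`.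
  refine ⟨algorithm, searchStep.cost + 8, fun n G X _ hX => ?_⟩
  have hr0 : rank ((inputState G X).arr 1) ((inputState G X).arr 3) n = 0 := by
    simp [rank, inputState]
  obtain ⟨t, r, hrun, ht, hr⟩ := exists_run_loop n _ _ (isValidInput_inputState G X hX)
    (3 ^ X.card) (inputState G X) rfl rfl rfl rfl (fun v _ _ => by simp [inputState])
    (.inr ⟨rfl, fun f _ a _ b _ _ _ => by rw [hr0]; exact Nat.zero_le _⟩)
    (by rw [hr0, count_inputState, zero_add])
  rw [count_inputState] at hr
  refine ⟨_, _, RAM.Run.seq hrun (RAM.Run.assign r 0 (.var 2)), ?_, ?_⟩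
  · have h1 : 1 ≤ 3 ^ X.card := Nat.one_le_pow _ _ (by omega)
    simp only [RAM.Expr.cost, Polynomial.eval_add, Polynomial.eval_ofNat]
    nlinarith
  · rcases hr with ⟨h2, g, a, b, hg, ha, hb, hga, hgb, ho⟩ | ⟨h2, hno⟩
    · refine .inl ⟨by simpa [RAM.Expr.value] using h2, fun v => ?_, ?_⟩
      · rw [ho v v.2]
        split_ifs <;> simp
      · have hset : {v : Fin n | r.arr 2 v = 1} = {v : Fin n | g v = 1} := by
          ext v
          simp [ho v v.2]
        show G.IsIndependentCutset {v : Fin n | r.arr 2 v = 1}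
        rw [hset]
        exact hg.isIndependentCutset (rowAdj_inputState G X) (a := ⟨a, ha⟩) (b := ⟨b, hb⟩) hga hgb
    · refine .inr ⟨by simpa [RAM.Expr.value] using h2, ?_⟩
      rintro ⟨S, hS⟩
      obtain ⟨g, hg, a, b, hga, hgb⟩ :=
        exists_isLabelling_of_isIndependentCutset (rowAdj_inputState G X) hS
      -- All ranks below `3 ^ k` have been ruled out, but every labelling has such a rank.
      have h3 := hno g hg a a.2 b b.2 hga hgb
      have h4 := rank_lt (X := (inputState G X).arr 1) fun v hv _ => hg.1 v hv
      rw [count_inputState] at h4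
      omega
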